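/- A (bivariate) copula $C$ is a distribution function with uniform marginals on $[0,1]$; $\mu_C$ denotes its doubly stochastic measure on $[0,1]^2$, so $C(x,y)=\mu_C([0,x]\times[0,y])$. Put $$\tau(C)=4\int C\,d\mu_C-1 ,\qquad \rho(C)=12\int_{[0,1]^2}C(x,y)\,d(x,y)-3 ,$$ and let $M(x,y)=\min\{x,y\}$ be the comonotonic and $\Pi(x,y)=xy$ the product copula. $C$ is an extreme-value copula (EVC) if there is a copula $B$ with $C(x,y)=\lim_{n\to\infty}B^n(x^{1/n},y^{1/n})$ for all $x,y\in[0,1]$. A Pickands dependence function is a convex function $A$ on $[0,1]$ with $\max\{1-t,t\}\le A(t)\le 1$ for all $t\in[0,1]$; a copula $C$ is induced by $A$, written $C=C_A$, if $C(x,y)=(xy)^{A(\ln x/\ln(xy))}$ for all $x,y\in(0,1)$. 1. Every EVC $C$ satisfies $\tau(C)\ge 0$ and the lower Hutchinson–Lai inequality $\rho(C)\ge -1+\sqrt{1+3\tau(C)}$. 2. A copula $C$ is an EVC with $\rho(C)=-1+\sqrt{1+3\tau(C)}$ if and only if $C=M$ or $C=\Pi$. 3. In terms of Pickands functions: if $C=C_A$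 for a Pickands dependence function $A$, then $\rho(C)=-1+\sqrt{1+3\tau(C)}$ holds if and only if $A(t)=\max\{t,1-t\}$ for all $t\in[0,1]$ or $A\equiv1$ on $[0,1]$; moreover $C=M$ if and only if $A(t)=\max\{t,1-t\}$ on $[0,1]$, and $C=\Pi$ if and only if $A\equiv 1$ on $[0,1]$. 4. Every EVC $C\notin\{M,\Pi\}$ satisfies $$\rho(C)\ \ge\ \frac{3\tau(C)}{2+\tau(C)}\ >\ \tau(C),$$ in particular $\rho(C)>\tau(C)$. -/

import Mathlib

open MeasureTheory Set Filter Topology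

/-- A two-dimensional copula, i.e. a bivariate distribution function with uniform marginals on
`[0,1]`. It is given by its doubly stochastic measure `μ_C`, carried by `[0,1]²` and regarded as a
measure on the plane; the copula as a function is `Copula.cdf`, which determines `μ_C`
(`Copula.ext_of_cdf`). -/
structure Copula where
  /-- the doubly stochastic measure of the copula -/
  measure : Measure (ℝ × ℝ)
  map_fst : measure.map Prod.fst = volume.restrict (Icc (0 : ℝ) 1)
  map_snd : measure.map Prod.snd = volume.restrict (Icc (0 : ℝ) 1)

namespace Copula

/-- The copula as a function, `C(x,y) = μ_C([0,x] × [0,y])` for `x, y ∈ [0,1]`. -/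
noncomputable def cdf (C : Copula) (x y : ℝ) : ℝ :=
  C.measure.real (Iic x ×ˢ Iic y)

/-- The comonotonic copula `M(x,y) = min x y`: the uniform distribution on the diagonal. -/
noncomputable def comonotonic : Copula where
  measure := (volume.restrict (Icc (0 : ℝ) 1)).map (fun x => (x, x))
  map_fst := by
    rw [Measure.map_map measurable_fst (by fun_prop)]
    exact Measure.map_id
  map_snd := by
    rw [Measure.map_map measurable_snd (by fun_prop)]
    exact Measure.map_id

/-- The product copula `Π(x,y) = x * y`: the uniform distribution on the unit square. -/
noncomputable def product : Copula where
  measure := (volume.restrict (Icc (0 : ℝ) 1)).prod (volume.restrict (Icc (0 : ℝ) 1))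
  map_fst := by
    rw [Measure.map_fst_prod]
    simp
  map_snd := by
    rw [Measure.map_snd_prod]
    simp

/-- Spearman's rho, `ρ(C) = 12 ∫_{[0,1]²} C(x,y) d(x,y) - 3`. -/
noncomputable def spearmanRho (C : Copula) : ℝ :=
  12 * (∫ p in Icc (0 : ℝ) 1 ×ˢ Icc (0 : ℝ) 1, C.cdf p.1 p.2) - 3

/-- Kendall's tau, `τ(C) = 4 ∫ C dμ_C - 1`. -/
noncomputable def kendallTau (C : Copula) : ℝ :=
  4 * (∫ p, C.cdf p.1 p.2 ∂C.measure) - 1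

/-- `C` is an extreme-value copula: there is a copula `B` with
`C(x,y) = lim_{n → ∞} B(x^{1/n}, y^{1/n})^n` for all `x, y ∈ [0,1]`. -/
def IsExtremeValue (C : Copula) : Prop :=
  ∃ B : Copula, ∀ x ∈ Icc (0 : ℝ) 1, ∀ y ∈ Icc (0 : ℝ) 1,
    Tendsto (fun n : ℕ => B.cdf (x ^ (1 / (n : ℝ))) (y ^ (1 / (n : ℝ))) ^ n) atTop
      (𝓝 (C.cdf x y))

/-- `C = C_A`, i.e. `C(x,y) = (xy)^{A(ln x / ln (xy))}` for all `x, y ∈ (0,1)`. -/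
def IsInducedBy (C : Copula) (A : ℝ → ℝ) : Prop :=
  ∀ x ∈ Ioo (0 : ℝ) 1, ∀ y ∈ Ioo (0 : ℝ) 1,
    C.cdf x y = (x * y) ^ A (Real.log x / Real.log (x * y))

instance (C : Copula) : IsProbabilityMeasure C.measure := by
  refine ⟨?_⟩
  have h := congrArg (fun m : Measure ℝ => m univ) C.map_fst
  simpa [Measure.map_apply measurable_fst MeasurableSet.univ] using h

theorem comonotonic_cdf {x y : ℝ} (hx : x ∈ Icc (0 : ℝ) 1) (hy : y ∈ Icc (0 : ℝ) 1) :
    comonotonic.cdf x y = min x y := by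
  have hp : (fun z : ℝ => (z, z)) ⁻¹' (Iic x ×ˢ Iic y) = Iic (min x y) := by
    ext z
    simp
  have hi : Iic (min x y) ∩ Icc (0 : ℝ) 1 = Icc 0 (min x y) := by
    ext z
    have := hx.2
    simp only [mem_inter_iff, mem_Iic, mem_Icc, le_min_iff]
    constructor
    · rintro ⟨h, h0, -⟩
      exact ⟨h0, h⟩
    · rintro ⟨h0, h⟩
      exact ⟨h, h0, h.1.trans this⟩
  simp only [cdf, comonotonic, Measure.real]
  rw [Measure.map_apply (by fun_prop) (measurableSet_Iic.prod measurableSet_Iic), hp,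
    Measure.restrict_apply measurableSet_Iic, hi, Real.volume_Icc, sub_zero,
    ENNReal.toReal_ofReal (le_min hx.1 hy.1)]

theorem product_cdf {x y : ℝ} (hx : x ∈ Icc (0 : ℝ) 1) (hy : y ∈ Icc (0 : ℝ) 1) :
    product.cdf x y = x * y := by
  have hi : ∀ z ∈ Icc (0 : ℝ) 1, Iic z ∩ Icc (0 : ℝ) 1 = Icc 0 z := by
    intro z hz
    ext w
    have := hz.2
    simp only [mem_inter_iff, mem_Iic, mem_Icc]
    constructor
    · rintro ⟨h, h0, -⟩
      exact ⟨h0, h⟩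
    · rintro ⟨h0, h⟩
      exact ⟨h, h0, h.trans this⟩
  simp only [cdf, product, Measure.real]
  rw [Measure.prod_prod, Measure.restrict_apply measurableSet_Iic,
    Measure.restrict_apply measurableSet_Iic, hi x hx, hi y hy, Real.volume_Icc, Real.volume_Icc,
    sub_zero, sub_zero, ENNReal.toReal_mul, ENNReal.toReal_ofReal hx.1,
    ENNReal.toReal_ofReal hy.1]

/-- A copula is determined by its values on `[0,1]²`. -/
theorem ext_of_cdf {C D : Copula}
    (h : ∀ x ∈ Icc (0 : ℝ) 1, ∀ y ∈ Icc (0 : ℝ) 1, C.cdf x y = D.cdf x y) : C = D := by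
  have ae0 : ∀ᵐ t ∂(volume.restrict (Icc (0 : ℝ) 1)), 0 < t ∧ t ≤ 1 := by
    rw [← Measure.restrict_congr_set Ioc_ae_eq_Icc]
    exact ae_restrict_mem measurableSet_Ioc
  have key : ∀ (E : Copula) (x y : ℝ), E.measure (Iic x ×ˢ Iic y)
      = E.measure (Iic (max 0 (min x 1)) ×ˢ Iic (max 0 (min y 1))) := by
    intro E x y
    have h1 : ∀ᵐ p ∂E.measure, 0 < p.1 ∧ p.1 ≤ 1 := by
      have := ae0
      rw [← E.map_fst] at this
      exact ae_of_ae_map measurable_fst.aemeasurable this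
    have h2 : ∀ᵐ p ∂E.measure, 0 < p.2 ∧ p.2 ≤ 1 := by
      have := ae0
      rw [← E.map_snd] at this
      exact ae_of_ae_map measurable_snd.aemeasurable this
    apply measure_congr
    filter_upwards [h1, h2] with p hp hq
    apply propext
    change (p.1 ≤ x ∧ p.2 ≤ y) ↔ (p.1 ≤ max 0 (min x 1) ∧ p.2 ≤ max 0 (min y 1))
    simp [not_le.mpr hp.1, not_le.mpr hq.1, hp.2, hq.2]
  have clamp : ∀ x : ℝ, max 0 (min x 1) ∈ Icc (0 : ℝ) 1 := fun x =>
    ⟨le_max_left _ _, max_le zero_le_one (min_le_right _ _)⟩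
  have hbox : ∀ x y : ℝ, C.measure (Iic x ×ˢ Iic y) = D.measure (Iic x ×ˢ Iic y) := by
    intro x y
    rw [key C, key D]
    exact (measureReal_eq_measureReal_iff).1 (h _ (clamp x) _ (clamp y))
  have hspan : IsCountablySpanning (range (Iic : ℝ → Set ℝ)) :=
    ⟨fun n : ℕ => Iic (n : ℝ), fun n => ⟨_, rfl⟩, iUnion_Iic_of_not_bddAbove_range (by
      rintro ⟨b, hb⟩
      obtain ⟨n, hn⟩ := exists_nat_gt b
      exact absurd (hb ⟨n, rfl⟩) (not_le.mpr hn))⟩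
  have hm : C.measure = D.measure := by
    refine ext_of_generate_finite (image2 (· ×ˢ ·) (range (Iic : ℝ → Set ℝ)) (range Iic))
      ?_ (isPiSystem_Iic.prod isPiSystem_Iic) ?_ (by simp)
    · refine (generateFrom_eq_prod ?_ ?_ hspan hspan).symm <;>
        rw [← borel_eq_generateFrom_Iic ℝ] <;> exact (BorelSpace.measurable_eq).symm
    · rintro _ ⟨_, ⟨x, rfl⟩, _, ⟨y, rfl⟩, rfl⟩
      exact hbox x y
  cases C
  cases D
  cases hm
  rfl

end Copula

/-- Pickands dependence functions: convex on `[0,1]` with `max {1-x, x} ≤ A(x) ≤ 1` there.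
Only the values on `[0,1]` matter. -/
def IsPickands (A : ℝ → ℝ) : Prop :=
  ConvexOn ℝ (Icc (0 : ℝ) 1) A ∧ ∀ x ∈ Icc (0 : ℝ) 1, max (1 - x) x ≤ A x ∧ A x ≤ 1

/-! For a Pickands function `A` with right derivative `d`, let `a = A + (1 - t) d` and `b = A - t d`
be the heights at `1` and `0` of the right tangent at `t`; both lie in `[0,1]`. The coordinates `x =
e^{-rt}`, `y = e^{-r(1-t)}` turn `C_A` into `e^{-r A(t)}`, and integrating out `r` gives `ρ = 12 I -
3` and `τ = 1 - T` with `I = ∫ 1/(1+A)²` and `T = ∫ ab/A²` (`spearmanRho_eq`, `kendallTau_eq`). The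
formula for `τ` rests on `∫ C dμ_C = 1/2 - ∫ ∂₁C ∂₂C`, valid here with one-sided partial derivatives
(`integral_cdf_eq_of_hasDerivWithinAt`).

The bound `3τ/(2+τ) ≤ ρ` is then the inequality `(1 - T)(1 - 2I) ≤ 4I - 1`
(`one_sub_tauIntegral_mul_le`). Take `g = t(1-t) (c/(1+A) - 1/A)` with `c = 1/(1-2I)`, the constant
for which `1/(1+A) ≤ 2I` says exactly that `g ≥ 0`. Since `d` is monotone and `g` vanishes at the
endpoints, `∫ g' d = -∫ g dd ≤ 0`. Pointwise, `g' d = c ((1+a)(1+b)/(1+A)² - 1) - (ab/A² - 1)`.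
Bounding `(1+a)(1+b)` below by `2(a+b)` leaves only exact derivatives, `I` and `T`.

Between `0` and `1`, `3τ/(2+τ)` strictly exceeds both `-1 + √(1+3τ)` and `τ`, so equality needs `τ =
0` or `τ = 1`. The bound `T ≤ 2 - 1/A(s)` gives `τ ≥ 0` and forces `A ≡ 1` when `τ = 0`; `τ = 1`
puts all mass on the diagonal.

Every extreme-value copula is some `C_A`: max-stability makes `ℓ(u,v) = -log C(e^{-u}, e^{-v})`
homogeneous, the rectangle inequality makes it submodular, and together these make `t ↦ ℓ(t, 1-t)` a
Pickands function. -/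

namespace IsPickands

/-! ### One-sided tangents of a Pickands function -/

variable {A : ℝ → ℝ}

/-- The right derivative of a Pickands function, extended monotonically to the real line. -/
noncomputable def slope (A : ℝ → ℝ) (t : ℝ) : ℝ :=
  if t ≤ 0 then -1 else if 1 ≤ t then 1 else derivWithin A (Ioi t) t

/-- The value at `1` of the right tangent to `A` at `t`. -/
noncomputable def tangentOne (A : ℝ → ℝ) (t : ℝ) : ℝ := A t + (1 - t) * slope A t

/-- The value at `0` of the right tangent to `A` at `t`. -/
noncomputable def tangentZero (A : ℝ → ℝ) (t : ℝ) : ℝ := A t - t * slope A t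

theorem le_one (h : IsPickands A) {t : ℝ} (ht : t ∈ Icc (0 : ℝ) 1) : A t ≤ 1 := (h.2 t ht).2

theorem self_le (h : IsPickands A) {t : ℝ} (ht : t ∈ Icc (0 : ℝ) 1) : t ≤ A t :=
  (le_max_right _ _).trans (h.2 t ht).1

theorem one_sub_le (h : IsPickands A) {t : ℝ} (ht : t ∈ Icc (0 : ℝ) 1) : 1 - t ≤ A t :=
  (le_max_left _ _).trans (h.2 t ht).1

theorem half_le (h : IsPickands A) {t : ℝ} (ht : t ∈ Icc (0 : ℝ) 1) : 1 / 2 ≤ A t := by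
  linarith [h.self_le ht, h.one_sub_le ht]

theorem zero (h : IsPickands A) : A 0 = 1 :=
  le_antisymm (h.le_one (by simp)) (by simpa using h.one_sub_le (t := 0) (by simp))

theorem one (h : IsPickands A) : A 1 = 1 :=
  le_antisymm (h.le_one (by simp)) (h.self_le (t := 1) (by simp))

theorem slope_of_mem {t : ℝ} (ht : t ∈ Ioo (0 : ℝ) 1) :
    slope A t = derivWithin A (Ioi t) t := by
  simp [slope, not_le.2 ht.1, not_le.2 ht.2]

theorem hasDerivWithinAt (h : IsPickands A) {t : ℝ} (ht : t ∈ Ioo (0 : ℝ) 1) :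
    HasDerivWithinAt A (slope A t) (Ioi t) t := by
  rw [slope_of_mem ht]
  exact h.1.hasDerivWithinAt_rightDeriv_of_mem_interior (by simpa using ht)

theorem tangentOne_le (h : IsPickands A) {t : ℝ} (ht : t ∈ Ioo (0 : ℝ) 1) :
    tangentOne A t ≤ 1 := by
  have := h.1.le_slope_of_hasDerivWithinAt_Ioi (Ioo_subset_Icc_self ht)
    (right_mem_Icc.2 zero_le_one) ht.2 (h.hasDerivWithinAt ht)
  rw [slope_def_field, le_div_iff₀ (by linarith [ht.2]), h.one] at this
  unfold tangentOne
  linarith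

/-- By convexity the chord from `0` to `t` is no steeper than the chord from `t` to any `y > t`; let
`y` decrease to `t`. -/
theorem chord_zero_le_slope (h : IsPickands A) {t : ℝ} (ht : t ∈ Ioo (0 : ℝ) 1) :
    A t - 1 ≤ t * slope A t := by
  have h1 : ∀ y ∈ Ioo t 1, (A t - 1) / t ≤ _root_.slope A t y := by
    intro y hy
    have := h.1.slope_mono_adjacent (left_mem_Icc.2 zero_le_one) ⟨(ht.1.trans hy.1).le, hy.2.le⟩
      ht.1 hy.1
    rw [slope_def_field]
    simpa [h.zero] using this
  have h2 := (hasDerivWithinAt_iff_tendsto_slope' (by simp)).1 (h.hasDerivWithinAt ht)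
  have h3 : (A t - 1) / t ≤ slope A t := by
    refine ge_of_tendsto h2 ?_
    filter_upwards [Ioo_mem_nhdsGT ht.2] with y hy using h1 y hy
  rw [div_le_iff₀ ht.1] at h3
  linarith

theorem tangentZero_le (h : IsPickands A) {t : ℝ} (ht : t ∈ Ioo (0 : ℝ) 1) :
    tangentZero A t ≤ 1 := by
  have := h.chord_zero_le_slope ht
  unfold tangentZero
  linarith

/-- The tangent is at least as steep as the chord from `(0, 1)`, and `A t ≥ 1 - t` keeps the
prolongation of that chord nonnegative at `1`. -/
theorem tangentOne_nonneg (h : IsPickands A) {t : ℝ} (ht : t ∈ Ioo (0 : ℝ) 1) :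
    0 ≤ tangentOne A t := by
  have h1 := h.chord_zero_le_slope ht
  have h2 := h.one_sub_le (Ioo_subset_Icc_self ht)
  have h3 : 0 ≤ t * tangentOne A t := by
    unfold tangentOne
    nlinarith [mul_le_mul_of_nonneg_left h1 (sub_nonneg.2 ht.2.le)]
  exact nonneg_of_mul_nonneg_right h3 ht.1

theorem tangentZero_nonneg (h : IsPickands A) {t : ℝ} (ht : t ∈ Ioo (0 : ℝ) 1) :
    0 ≤ tangentZero A t := by
  have h1 := h.tangentOne_le ht
  have h2 := h.self_le (Ioo_subset_Icc_self ht)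
  have h3 : 0 ≤ (1 - t) * tangentZero A t := by
    unfold tangentOne at h1
    unfold tangentZero
    nlinarith [mul_le_mul_of_nonneg_left h1 ht.1.le]
  exact nonneg_of_mul_nonneg_right h3 (sub_pos.2 ht.2)

theorem abs_slope_le (h : IsPickands A) (t : ℝ) : |slope A t| ≤ 1 := by
  by_cases ht : t ∈ Ioo (0 : ℝ) 1
  · have h1 := h.tangentOne_le ht
    have h2 := h.tangentZero_nonneg ht
    have h3 := h.tangentOne_nonneg ht
    have h4 := h.tangentZero_le ht
    have : slope A t = tangentOne A t - tangentZero A t := by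
      unfold tangentOne tangentZero
      ring
    rw [this, abs_le]
    constructor <;> linarith
  · unfold slope
    split_ifs with h1 h2
    · simp
    · simp
    · exact absurd ⟨not_le.1 h1, not_le.1 h2⟩ ht

/-- Outside `(0,1)` the values `-1` and `1` are the extremes permitted by `abs_slope_le`, so the
extension stays monotone. This yields Borel measurability on all of `ℝ`. -/
theorem monotone_slope (h : IsPickands A) : Monotone (slope A) := by
  intro s t hst
  have hs := abs_le.1 (h.abs_slope_le s)
  have ht := abs_le.1 (h.abs_slope_le t)
  by_cases h0 : s ≤ 0
  · have : slope A s = -1 := by simp [slope, h0]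
    linarith
  by_cases h1 : 1 ≤ t
  · have : slope A t = 1 := by
      simp [slope, h1, not_le.2 (zero_lt_one.trans_le h1)]
    linarith
  push Not at h0 h1
  have ms : s ∈ Ioo (0 : ℝ) 1 := ⟨h0, hst.trans_lt h1⟩
  have mt : t ∈ Ioo (0 : ℝ) 1 := ⟨h0.trans_le hst, h1⟩
  rw [slope_of_mem ms, slope_of_mem mt]
  exact h.1.monotoneOn_rightDeriv (by simpa using ms) (by simpa using mt) hst

theorem continuousOn (h : IsPickands A) : ContinuousOn A (Icc 0 1) := by
  have key : ∀ a : ℝ, a = 0 ∨ a = 1 → A a = 1 → Tendsto (fun t => max (1 - t) t) (𝓝 a) (𝓝 1) →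
      ContinuousWithinAt A (Icc 0 1) a := by
    intro a ha hA hl
    unfold ContinuousWithinAt
    rw [hA]
    refine tendsto_of_tendsto_of_tendsto_of_le_of_le' (hl.mono_left inf_le_left)
      tendsto_const_nhds ?_ ?_
    · filter_upwards [self_mem_nhdsWithin] with t ht using (h.2 t ht).1
    · filter_upwards [self_mem_nhdsWithin] with t ht using (h.2 t ht).2
  intro t ht
  rcases ht.1.eq_or_lt with h0 | h0
  · refine key t (Or.inl h0.symm) (by rw [← h0, h.zero]) ?_
    have : Continuous fun t : ℝ => max (1 - t) t := by fun_prop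
    simpa [← h0] using this.tendsto t
  rcases ht.2.eq_or_lt with h1 | h1
  · refine key t (Or.inr h1) (by rw [h1, h.one]) ?_
    have : Continuous fun t : ℝ => max (1 - t) t := by fun_prop
    simpa [h1] using this.tendsto t
  have := h.1.continuousOn_interior
  rw [interior_Icc] at this
  exact (this.continuousAt (Ioo_mem_nhds h0 h1)).continuousWithinAt

end IsPickands

/-! ### Integration by parts against a monotone function -/

/-- If `g ≥ 0` vanishes at the endpoints, then `g'` integrates nonpositively against a monotone
function. -/
theorem integral_rightDeriv_mul_monotone_nonpos {g g' d : ℝ → ℝ} (hd : Monotone d)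
    (hd1 : ∀ t, |d t| ≤ 1) (hg : ContinuousOn g (Icc 0 1))
    (hg' : ∀ t ∈ Ioo (0 : ℝ) 1, HasDerivWithinAt g (g' t) (Ioi t) t)
    (hint : IntegrableOn g' (Ioo 0 1)) (hg0 : ∀ t ∈ Icc (0 : ℝ) 1, 0 ≤ g t)
    (h0 : g 0 = 0) (h1 : g 1 = 0) :
    ∫ t in Ioo (0 : ℝ) 1, g' t * d t ≤ 0 := by
  have ftc : ∀ a ∈ Icc (0 : ℝ) 1, ∫ t in Ioc a 1, g' t = - g a := by
    intro a ha
    rw [← intervalIntegral.integral_of_le ha.2,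
      intervalIntegral.integral_eq_sub_of_hasDeriv_right (f := g), h1, zero_sub]
    · rw [uIcc_of_le ha.2]
      exact hg.mono (Icc_subset_Icc_left ha.1)
    · rw [min_eq_left ha.2, max_eq_right ha.2]
      exact fun t ht => hg' t ⟨ha.1.trans_lt ht.1, ht.2⟩
    · rw [intervalIntegrable_iff_integrableOn_Ioo_of_le ha.2]
      exact hint.mono_set (Ioo_subset_Ioo_left ha.1)
  -- A superlevel set of the monotone `d` is, up to a null set, an interval `(a, 1]`, over which
  -- `g'` integrates to `-g a ≤ 0`.
  have upper : ∀ s : ℝ, ∫ t in Ioo (0 : ℝ) 1, (Iio (d t)).indicator (fun _ => g' t) s ≤ 0 := by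
    intro s
    set U : Set ℝ := {t | s < d t} with hU
    have e1 : ∫ t in Ioo (0 : ℝ) 1, (Iio (d t)).indicator (fun _ => g' t) s
        = ∫ t in Ioo (0 : ℝ) 1 ∩ U, g' t := by
      rw [← setIntegral_indicator (measurableSet_lt measurable_const hd.measurable)]
      rfl
    rw [e1]
    by_cases hne : (Ioo (0 : ℝ) 1 ∩ U).Nonempty
    · set a := sInf (Ioo (0 : ℝ) 1 ∩ U)
      have hb : BddBelow (Ioo (0 : ℝ) 1 ∩ U) := ⟨0, fun t ht => ht.1.1.le⟩
      have ha : a ∈ Icc (0 : ℝ) 1 := by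
        obtain ⟨t, ht⟩ := hne
        exact ⟨le_csInf ⟨t, ht⟩ fun t ht => ht.1.1.le, (csInf_le hb ht).trans ht.1.2.le⟩
      have e2 : (Ioo (0 : ℝ) 1 ∩ U : Set ℝ) =ᵐ[volume] Ioc a 1 := by
        have l1 : Ioo a 1 ⊆ Ioo (0 : ℝ) 1 ∩ U := by
          intro t ht
          obtain ⟨r, hr, hrt⟩ := exists_lt_of_csInf_lt hne ht.1
          exact ⟨⟨ha.1.trans_lt ht.1, ht.2⟩, lt_of_lt_of_le hr.2 (hd hrt.le)⟩
        have l2 : Ioo (0 : ℝ) 1 ∩ U ⊆ Icc a 1 := fun t ht => ⟨csInf_le hb ht, ht.1.2.le⟩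
        have n1 : Ioo a 1 =ᵐ[volume] Ioc a 1 := Ioo_ae_eq_Ioc
        have n2 : Icc a 1 =ᵐ[volume] Ioc a 1 := Ioc_ae_eq_Icc.symm
        filter_upwards [n1, n2] with t ht1 ht2
        apply propext
        constructor
        · intro ht
          exact (iff_of_eq ht2).1 (l2 ht)
        · intro ht
          exact l1 ((iff_of_eq ht1).2 ht)
      rw [setIntegral_congr_set e2, ftc a ha]
      linarith [hg0 a ha]
    · rw [not_nonempty_iff_eq_empty.1 hne]
      simp
  -- Layer-cake formula: `d + 1` is the integral over `s ∈ (-1, 1]` of the indicator of `s < d`.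
  -- Replacing `d` by `d + 1` is harmless because `g'` has integral zero.
  have layer : ∀ t, ∫ s in Ioc (-1 : ℝ) 1, (Iio (d t)).indicator (fun _ => g' t) s
      = g' t * (d t + 1) := by
    intro t
    have hdt := abs_le.1 (hd1 t)
    rw [setIntegral_indicator measurableSet_Iio]
    have : (Ioc (-1) 1 ∩ Iio (d t) : Set ℝ) = Ioo (-1) (d t) := by
      ext s
      simp only [mem_inter_iff, mem_Ioc, mem_Iio, mem_Ioo]
      constructor
      · rintro ⟨h, h'⟩
        exact ⟨h.1, h'⟩
      · rintro ⟨h, h'⟩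
        exact ⟨⟨h, h'.le.trans hdt.2⟩, h'⟩
    rw [this, setIntegral_const]
    simp only [Measure.real, Real.volume_Ioo, smul_eq_mul]
    rw [ENNReal.toReal_ofReal (by linarith)]
    ring
  have hmeas : MeasurableSet {p : ℝ × ℝ | p.2 < d p.1} :=
    measurableSet_lt measurable_snd (hd.measurable.comp measurable_fst)
  have hprod : Integrable (fun p : ℝ × ℝ => (Iio (d p.1)).indicator (fun _ => g' p.1) p.2)
      ((volume.restrict (Ioo (0 : ℝ) 1)).prod (volume.restrict (Ioc (-1 : ℝ) 1))) := by
    have : Integrable (fun p : ℝ × ℝ => g' p.1)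
        ((volume.restrict (Ioo (0 : ℝ) 1)).prod (volume.restrict (Ioc (-1 : ℝ) 1))) :=
      Integrable.comp_fst hint _
    exact this.indicator hmeas
  have swap := integral_integral_swap (f := fun t s => (Iio (d t)).indicator (fun _ => g' t) s) hprod
  have hz : ∫ t in Ioo (0 : ℝ) 1, g' t = 0 := by
    rw [← integral_Ioc_eq_integral_Ioo, ftc 0 (by simp), h0, neg_zero]
  have hI : IntegrableOn (fun t => g' t * (d t + 1)) (Ioo 0 1) := by
    have := hprod.integral_prod_left
    simp only [layer] at this
    exact this
  calc ∫ t in Ioo (0 : ℝ) 1, g' t * d t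
      = ∫ t in Ioo (0 : ℝ) 1, (g' t * (d t + 1) - g' t) := by
        congr 1; ext t; ring
    _ = ∫ t in Ioo (0 : ℝ) 1, g' t * (d t + 1) := by
        rw [integral_sub hI hint, hz, sub_zero]
    _ = ∫ s in Ioc (-1 : ℝ) 1, ∫ t in Ioo (0 : ℝ) 1, (Iio (d t)).indicator (fun _ => g' t) s := by
        rw [← swap]
        simp only [layer]
    _ ≤ 0 := integral_nonpos upper

/-! ### The inequality between the two integrals -/

namespace IsPickands

variable {A : ℝ → ℝ}

/-- The integral determining Spearman's rho of the copula induced by `A`. -/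
noncomputable def rhoIntegral (A : ℝ → ℝ) : ℝ := ∫ t in Ioo (0 : ℝ) 1, 1 / (1 + A t) ^ 2

/-- The integral determining Kendall's tau of the copula induced by `A`. -/
noncomputable def tauIntegral (A : ℝ → ℝ) : ℝ :=
  ∫ t in Ioo (0 : ℝ) 1, tangentOne A t * tangentZero A t / A t ^ 2

theorem aemeasurable (h : IsPickands A) : AEMeasurable A (volume.restrict (Ioo 0 1)) :=
  (h.continuousOn.mono Ioo_subset_Icc_self).aemeasurable measurableSet_Ioo

theorem aemeasurable_tangentOne (h : IsPickands A) :
    AEMeasurable (tangentOne A) (volume.restrict (Ioo 0 1)) := by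
  have h1 := h.aemeasurable
  have h2 := h.monotone_slope.measurable
  unfold tangentOne
  fun_prop

theorem aemeasurable_tangentZero (h : IsPickands A) :
    AEMeasurable (tangentZero A) (volume.restrict (Ioo 0 1)) := by
  have h1 := h.aemeasurable
  have h2 := h.monotone_slope.measurable
  unfold tangentZero
  fun_prop

theorem integrableOn_of_bound {f : ℝ → ℝ} {a b : ℝ} (ha : 0 ≤ a) (hb : b ≤ 1)
    (hf : AEMeasurable f (volume.restrict (Ioo 0 1))) (c : ℝ)
    (hc : ∀ t ∈ Ioo (0 : ℝ) 1, |f t| ≤ c) : IntegrableOn f (Ioo a b) := by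
  have : IntegrableOn f (Ioo 0 1) :=
    Integrable.of_bound hf.aestronglyMeasurable c
      ((ae_restrict_iff' measurableSet_Ioo).2 (Eventually.of_forall hc))
  exact this.mono_set (Ioo_subset_Ioo ha hb)

theorem integrableOn_div_sq (h : IsPickands A) {f : ℝ → ℝ} {a b : ℝ} (ha : 0 ≤ a) (hb : b ≤ 1)
    (hf : AEMeasurable f (volume.restrict (Ioo 0 1))) {k : ℝ} (hk : 0 ≤ k) (c : ℝ)
    (hc : ∀ t ∈ Ioo (0 : ℝ) 1, |f t| ≤ c) :
    IntegrableOn (fun t => f t / (k + A t) ^ 2) (Ioo a b) := by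
  have h1 := h.aemeasurable
  refine integrableOn_of_bound ha hb (by fun_prop) (c * 4) fun t ht => ?_
  have h2 := h.half_le (Ioo_subset_Icc_self ht)
  have h3 : 1 / 4 ≤ (k + A t) ^ 2 := by nlinarith
  have h4 := hc t ht
  rw [abs_div, abs_of_nonneg (sq_nonneg (k + A t)), div_le_iff₀ (by linarith)]
  nlinarith [abs_nonneg (f t)]

theorem integral_rightDeriv {g g' : ℝ → ℝ} {a b : ℝ} (ha : 0 ≤ a) (hab : a ≤ b) (hb : b ≤ 1)
    (hg : ContinuousOn g (Icc 0 1))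
    (hg' : ∀ t ∈ Ioo (0 : ℝ) 1, HasDerivWithinAt g (g' t) (Ioi t) t)
    (hint : IntegrableOn g' (Ioo a b)) : ∫ t in Ioo a b, g' t = g b - g a := by
  rw [← integral_Ioc_eq_integral_Ioo, ← intervalIntegral.integral_of_le hab]
  refine intervalIntegral.integral_eq_sub_of_hasDeriv_right ?_ ?_ ?_
  · rw [uIcc_of_le hab]
    exact hg.mono (Icc_subset_Icc ha hb)
  · rw [min_eq_left hab, max_eq_right hab]
    exact fun t ht => hg' t ⟨ha.trans_lt ht.1, ht.2.trans_le hb⟩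
  · rwa [intervalIntegrable_iff_integrableOn_Ioo_of_le hab]

theorem add_pos (h : IsPickands A) {k t : ℝ} (hk : 0 ≤ k) (ht : t ∈ Icc (0 : ℝ) 1) :
    0 < k + A t := by linarith [h.half_le ht]

theorem continuousOn_div (h : IsPickands A) {f : ℝ → ℝ} (hf : Continuous f) {k : ℝ}
    (hk : 0 ≤ k) : ContinuousOn (fun t => f t / (k + A t)) (Icc 0 1) :=
  hf.continuousOn.div (continuousOn_const.add h.continuousOn) fun _ ht => (h.add_pos hk ht).ne'

theorem bound_zero (h : IsPickands A) {k : ℝ} (hk : 0 ≤ k) :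
    ∀ t ∈ Ioo (0 : ℝ) 1, |k + tangentZero A t| ≤ k + 1 := fun t ht => by
  rw [abs_of_nonneg (add_nonneg hk (h.tangentZero_nonneg ht))]
  linarith [h.tangentZero_le ht]

theorem bound_one (h : IsPickands A) {k : ℝ} (hk : 0 ≤ k) :
    ∀ t ∈ Ioo (0 : ℝ) 1, |k + tangentOne A t| ≤ k + 1 := fun t ht => by
  rw [abs_of_nonneg (add_nonneg hk (h.tangentOne_nonneg ht))]
  linarith [h.tangentOne_le ht]

theorem integrableOn_tangentZero (h : IsPickands A) {k a b : ℝ} (hk : 0 ≤ k) (ha : 0 ≤ a)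
    (hb : b ≤ 1) : IntegrableOn (fun t => (k + tangentZero A t) / (k + A t) ^ 2) (Ioo a b) :=
  h.integrableOn_div_sq ha hb (h.aemeasurable_tangentZero.const_add k) hk _ (h.bound_zero hk)

theorem integrableOn_tangentOne (h : IsPickands A) {k a b : ℝ} (hk : 0 ≤ k) (ha : 0 ≤ a)
    (hb : b ≤ 1) : IntegrableOn (fun t => (k + tangentOne A t) / (k + A t) ^ 2) (Ioo a b) :=
  h.integrableOn_div_sq ha hb (h.aemeasurable_tangentOne.const_add k) hk _ (h.bound_one hk)

/-- The integrand is the right derivative of `t / (k + A t)`. The value `k = 1` serves the integral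
for rho, `k = 0` the one for tau. -/
theorem integral_tangentZero (h : IsPickands A) {k a b : ℝ} (hk : 0 ≤ k) (ha : 0 ≤ a)
    (hab : a ≤ b) (hb : b ≤ 1) :
    ∫ t in Ioo a b, (k + tangentZero A t) / (k + A t) ^ 2 = b / (k + A b) - a / (k + A a) := by
  refine integral_rightDeriv ha hab hb (h.continuousOn_div continuous_id hk) (fun t ht => ?_)
    (h.integrableOn_tangentZero hk ha hb)
  have hp := h.add_pos hk (Ioo_subset_Icc_self ht)
  refine ((hasDerivAt_id' t).hasDerivWithinAt.div ((h.hasDerivWithinAt ht).const_add k)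
    hp.ne').congr_deriv ?_
  simp only [tangentZero]
  ring

theorem integral_tangentOne (h : IsPickands A) {k a b : ℝ} (hk : 0 ≤ k) (ha : 0 ≤ a)
    (hab : a ≤ b) (hb : b ≤ 1) :
    ∫ t in Ioo a b, (k + tangentOne A t) / (k + A t) ^ 2
      = (1 - a) / (k + A a) - (1 - b) / (k + A b) := by
  have := integral_rightDeriv ha hab hb
    (h.continuousOn_div (f := fun t => t - 1) (by fun_prop) hk)
    (g' := fun t => (k + tangentOne A t) / (k + A t) ^ 2) (fun t ht => ?_)
    (h.integrableOn_tangentOne hk ha hb)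
  · rw [this]
    ring
  · have hp := h.add_pos hk (Ioo_subset_Icc_self ht)
    refine (((hasDerivAt_id' t).hasDerivWithinAt.sub_const 1).div
      ((h.hasDerivWithinAt ht).const_add k) hp.ne').congr_deriv ?_
    simp only [tangentOne]
    ring

theorem setIntegral_split {f : ℝ → ℝ} (hf : IntegrableOn f (Ioo 0 1)) {s : ℝ}
    (hs : s ∈ Ioo (0 : ℝ) 1) :
    ∫ t in Ioo (0 : ℝ) 1, f t = (∫ t in Ioo 0 s, f t) + ∫ t in Ioo s 1, f t := by
  rw [← Ioc_union_Ioo_eq_Ioo hs.1.le hs.2, setIntegral_union _ measurableSet_Ioo,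
    integral_Ioc_eq_integral_Ioo]
  · exact hf.mono_set (Ioc_subset_Ioo_right hs.2)
  · exact hf.mono_set (Ioo_subset_Ioo_left hs.1.le)
  · exact Set.disjoint_left.2 fun t ht ht' => not_lt.2 ht.2 ht'.1

theorem integrableOn_rho (h : IsPickands A) :
    IntegrableOn (fun t => 1 / (1 + A t) ^ 2) (Ioo 0 1) :=
  h.integrableOn_div_sq le_rfl le_rfl (f := fun _ => 1) (by fun_prop) zero_le_one 1 (by simp)

theorem integrableOn_tau (h : IsPickands A) :
    IntegrableOn (fun t => tangentOne A t * tangentZero A t / A t ^ 2) (Ioo 0 1) := by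
  have := h.integrableOn_div_sq le_rfl le_rfl (k := 0)
    (h.aemeasurable_tangentOne.mul h.aemeasurable_tangentZero) le_rfl 1 fun t ht => by
      have h1 := h.tangentOne_nonneg ht
      have h2 := h.tangentZero_nonneg ht
      rw [Pi.mul_apply, abs_of_nonneg (mul_nonneg h1 h2)]
      exact mul_le_one₀ (h.tangentOne_le ht) h2 (h.tangentZero_le ht)
  simpa using this

/-- With the tangent heights at most `1`, `2/(1+A)²` dominates `(1+b)/(1+A)²` on `(0,s)` and
`(1+a)/(1+A)²` on `(s,1)`. These are exact derivatives, with integrals `s/(1+A s)` and `(1-s)/(1+A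
s)`. -/
theorem inv_le_two_mul_rhoIntegral (h : IsPickands A) {s : ℝ} (hs : s ∈ Ioo (0 : ℝ) 1) :
    1 / (1 + A s) ≤ 2 * rhoIntegral A := by
  have i0 := h.integrableOn_rho
  have hp : ∀ t ∈ Ioo (0 : ℝ) 1, 0 < (1 + A t) ^ 2 := fun t ht =>
    pow_pos (h.add_pos zero_le_one (Ioo_subset_Icc_self ht)) 2
  have b0 : s / (1 + A s) ≤ 2 * ∫ t in Ioo 0 s, 1 / (1 + A t) ^ 2 := by
    have := h.integral_tangentZero zero_le_one le_rfl hs.1.le hs.2.le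
    rw [zero_div, sub_zero] at this
    rw [← this, ← integral_const_mul]
    refine setIntegral_mono_on (h.integrableOn_tangentZero zero_le_one le_rfl hs.2.le)
      ((i0.mono_set (Ioo_subset_Ioo_right hs.2.le)).const_mul 2) measurableSet_Ioo fun t ht => ?_
    have ht' : t ∈ Ioo (0 : ℝ) 1 := ⟨ht.1, ht.2.trans hs.2⟩
    rw [mul_one_div]
    exact div_le_div_of_nonneg_right (by linarith [h.tangentZero_le ht']) (hp t ht').le
  have b1 : (1 - s) / (1 + A s) ≤ 2 * ∫ t in Ioo s 1, 1 / (1 + A t) ^ 2 := by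
    have := h.integral_tangentOne zero_le_one hs.1.le hs.2.le le_rfl
    rw [sub_self, zero_div, sub_zero] at this
    rw [← this, ← integral_const_mul]
    refine setIntegral_mono_on (h.integrableOn_tangentOne zero_le_one hs.1.le le_rfl)
      ((i0.mono_set (Ioo_subset_Ioo_left hs.1.le)).const_mul 2) measurableSet_Ioo fun t ht => ?_
    have ht' : t ∈ Ioo (0 : ℝ) 1 := ⟨hs.1.trans ht.1, ht.2⟩
    rw [mul_one_div]
    exact div_le_div_of_nonneg_right (by linarith [h.tangentOne_le ht']) (hp t ht').le
  unfold rhoIntegral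
  rw [setIntegral_split i0 hs, mul_add]
  refine le_trans (le_of_eq ?_) (add_le_add b0 b1)
  rw [← add_div]
  ring

/-- Bound `ab` by `a` on `(0,s)` and by `b` on `(s,1)`; what remains is exact. As `s` is free, this
controls `A` at every point, which settles the case `τ = 0`. -/
theorem tauIntegral_le (h : IsPickands A) {s : ℝ} (hs : s ∈ Ioo (0 : ℝ) 1) :
    tauIntegral A ≤ 2 - 1 / A s := by
  have i0 := h.integrableOn_tau
  have hp : ∀ t ∈ Ioo (0 : ℝ) 1, 0 ≤ A t ^ 2 := fun t _ => sq_nonneg _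
  have b0 : (∫ t in Ioo 0 s, tangentOne A t * tangentZero A t / A t ^ 2) ≤ 1 - (1 - s) / A s := by
    have e := h.integral_tangentOne le_rfl le_rfl hs.1.le hs.2.le
    have i1 := h.integrableOn_tangentOne le_rfl le_rfl hs.2.le
    simp only [zero_add, sub_zero, h.zero, div_one] at e i1
    rw [← e]
    refine setIntegral_mono_on (i0.mono_set (Ioo_subset_Ioo_right hs.2.le)) i1
      measurableSet_Ioo fun t ht => ?_
    have ht' : t ∈ Ioo (0 : ℝ) 1 := ⟨ht.1, ht.2.trans hs.2⟩
    exact div_le_div_of_nonneg_right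
      (mul_le_of_le_one_right (h.tangentOne_nonneg ht') (h.tangentZero_le ht')) (hp t ht')
  have b1 : (∫ t in Ioo s 1, tangentOne A t * tangentZero A t / A t ^ 2) ≤ 1 - s / A s := by
    have e := h.integral_tangentZero le_rfl hs.1.le hs.2.le le_rfl
    have i1 := h.integrableOn_tangentZero le_rfl hs.1.le le_rfl
    simp only [zero_add, h.one, div_one] at e i1
    rw [← e]
    refine setIntegral_mono_on (i0.mono_set (Ioo_subset_Ioo_left hs.1.le)) i1
      measurableSet_Ioo fun t ht => ?_
    have ht' : t ∈ Ioo (0 : ℝ) 1 := ⟨hs.1.trans ht.1, ht.2⟩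
    exact div_le_div_of_nonneg_right
      (mul_le_of_le_one_left (h.tangentZero_nonneg ht') (h.tangentOne_le ht')) (hp t ht')
  unfold tauIntegral
  rw [setIntegral_split i0 hs]
  refine (add_le_add b0 b1).trans (le_of_eq ?_)
  ring

/-- Since `A ≥ 1/2`, the integrand is at most `4/9`; this makes `1 - 2I` positive. -/
theorem rhoIntegral_le (h : IsPickands A) : rhoIntegral A ≤ 4 / 9 := by
  have : rhoIntegral A ≤ ∫ t in Ioo (0 : ℝ) 1, (4 / 9 : ℝ) := by
    refine setIntegral_mono_on h.integrableOn_rho (by simp) measurableSet_Ioo fun t ht => ?_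
    have := h.half_le (Ioo_subset_Icc_self ht)
    rw [div_le_iff₀ (by positivity)]
    nlinarith
  simpa using this

/-- The heart of the matter: in terms of `ρ` and `τ` this reads `3τ ≤ ρ (2 + τ)`. It comes from
testing the monotone slope against the derivative of a nonnegative `g` vanishing at both ends. -/
theorem one_sub_tauIntegral_mul_le (h : IsPickands A) :
    (1 - tauIntegral A) * (1 - 2 * rhoIntegral A) ≤ 4 * rhoIntegral A - 1 := by
  set I := rhoIntegral A with hI
  have hI1 := h.rhoIntegral_le
  have hc0 : 0 < 1 - 2 * I := by linarith
  set c := 1 / (1 - 2 * I) with hc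
  have hcpos : 0 < c := by positivity
  set g : ℝ → ℝ := fun t => c * (t * (1 - t) / (1 + A t)) - t * (1 - t) / (0 + A t) with hg
  set g' : ℝ → ℝ := fun t =>
    c * (((1 - 2 * t) * (1 + A t) - t * (1 - t) * slope A t) / (1 + A t) ^ 2)
      - ((1 - 2 * t) * (0 + A t) - t * (1 - t) * slope A t) / (0 + A t) ^ 2 with hg'
  have hA := h.aemeasurable
  have hd := h.monotone_slope.measurable
  have ibd : ∀ k : ℝ, 0 ≤ k → IntegrableOn (fun t =>
      ((1 - 2 * t) * (k + A t) - t * (1 - t) * slope A t) / (k + A t) ^ 2) (Ioo 0 1) := by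
    intro k hk
    refine h.integrableOn_div_sq le_rfl le_rfl (by fun_prop) hk (k + 2) fun t ht => ?_
    have h1 := abs_le.1 (h.abs_slope_le t)
    have h2 := h.half_le (Ioo_subset_Icc_self ht)
    have h3 := h.le_one (Ioo_subset_Icc_self ht)
    have h4 : |(1 - 2 * t) * (k + A t)| ≤ k + 1 := by
      rw [abs_mul, abs_of_pos (h.add_pos hk (Ioo_subset_Icc_self ht))]
      have : |1 - 2 * t| ≤ 1 := abs_le.2 ⟨by linarith [ht.2], by linarith [ht.1]⟩
      nlinarith [abs_nonneg (1 - 2 * t)]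
    have h5 : |t * (1 - t) * slope A t| ≤ 1 := by
      rw [abs_mul, abs_of_nonneg (mul_nonneg ht.1.le (sub_nonneg.2 ht.2.le))]
      exact mul_le_one₀ (by nlinarith [ht.1, ht.2]) (abs_nonneg _) (h.abs_slope_le t)
    exact (abs_sub _ _).trans (by linarith)
  have main : ∫ t in Ioo (0 : ℝ) 1, g' t * slope A t ≤ 0 := by
    refine integral_rightDeriv_mul_monotone_nonpos (g := g) h.monotone_slope h.abs_slope_le
      ?_ ?_ ?_ ?_ (by simp [hg]) (by simp [hg])
    · exact (continuousOn_const.mul (h.continuousOn_div (by fun_prop) zero_le_one)).sub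
        (h.continuousOn_div (by fun_prop) le_rfl)
    · intro t ht
      have hn : HasDerivWithinAt (fun t : ℝ => t * (1 - t)) (1 - 2 * t) (Ioi t) t := by
        refine ((hasDerivAt_id' t).hasDerivWithinAt.mul
          ((hasDerivAt_id' t).hasDerivWithinAt.const_sub 1)).congr_deriv ?_
        ring
      have hk : ∀ k : ℝ, 0 ≤ k → HasDerivWithinAt (fun t => t * (1 - t) / (k + A t))
          (((1 - 2 * t) * (k + A t) - t * (1 - t) * slope A t) / (k + A t) ^ 2) (Ioi t) t :=
        fun k hk => hn.div ((h.hasDerivWithinAt ht).const_add k)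
          (h.add_pos hk (Ioo_subset_Icc_self ht)).ne'
      exact ((hk 1 zero_le_one).const_mul c).sub (hk 0 le_rfl)
    · exact ((ibd 1 zero_le_one).const_mul c).sub (ibd 0 le_rfl)
    · intro t ht
      rcases ht.1.eq_or_lt with h0 | h0
      · simp [hg, ← h0]
      rcases ht.2.eq_or_lt with h1 | h1
      · simp [hg, h1]
      have hA1 := h.add_pos zero_le_one ht
      have hA0 := h.add_pos le_rfl ht
      -- The inequality `1 / A ≤ c / (1 + A)` is equivalent to `1 ≤ 2 I (1 + A)`, which is where the
      -- choice of `c` comes from.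
      have h2 := h.inv_le_two_mul_rhoIntegral ⟨h0, h1⟩
      rw [← hI, div_le_iff₀ hA1] at h2
      have h3 : 1 / (0 + A t) ≤ c / (1 + A t) := by
        rw [hc, div_div, one_div_le_one_div hA0 (by positivity)]
        linarith
      have h4 := mul_le_mul_of_nonneg_left h3 (mul_nonneg h0.le (sub_nonneg.2 h1.le))
      simp only [hg, sub_nonneg]
      calc t * (1 - t) / (0 + A t) = t * (1 - t) * (1 / (0 + A t)) := by ring
        _ ≤ _ := h4
        _ = _ := by ring
  have i0 := h.integrableOn_tangentZero (k := 1) zero_le_one le_rfl le_rfl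
  have i1 := h.integrableOn_tangentOne (k := 1) zero_le_one le_rfl le_rfl
  have e0 := h.integral_tangentZero (k := 1) zero_le_one le_rfl zero_le_one le_rfl
  have e1 := h.integral_tangentOne (k := 1) zero_le_one le_rfl zero_le_one le_rfl
  rw [h.one, h.zero] at e0 e1
  have ir := h.integrableOn_rho
  have it := h.integrableOn_tau
  -- Here `2(a+b)`, the lower bound for `(1+a)(1+b)`, is written as `2(1+a) + 2(1+b) - 4`, so that
  -- the first two terms become exact derivatives after division by `(1+A)²`.
  have low : ∫ t in Ioo (0 : ℝ) 1, (c * (2 * ((1 + tangentZero A t) / (1 + A t) ^ 2)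
        + 2 * ((1 + tangentOne A t) / (1 + A t) ^ 2) - 4 * (1 / (1 + A t) ^ 2) - 1)
        - (tangentOne A t * tangentZero A t / A t ^ 2 - 1))
      ≤ ∫ t in Ioo (0 : ℝ) 1, g' t * slope A t := by
    refine setIntegral_mono_on ?_ ?_ measurableSet_Ioo fun t ht => ?_
    · exact (((((i0.const_mul 2).add (i1.const_mul 2)).sub (ir.const_mul 4)).sub
        (integrableOn_const (by simp))).const_mul c).sub (it.sub (integrableOn_const (by simp)))
    · refine Integrable.mul_bdd (c := 1) (((ibd 1 zero_le_one).const_mul c).sub (ibd 0 le_rfl))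
        hd.aestronglyMeasurable (Eventually.of_forall h.abs_slope_le)
    · have hA1 := h.add_pos zero_le_one (Ioo_subset_Icc_self ht)
      have hA0 := h.add_pos le_rfl (Ioo_subset_Icc_self ht)
      rw [zero_add] at hA0
      -- Both parts of `g'` use `(k+a)(k+b) = (k+A)² + (1-2t)(k+A) d - t(1-t) d²`, for `k = 1` and
      -- `k = 0`.
      have p1 : g' t * slope A t = c * ((tangentOne A t * tangentZero A t + tangentOne A t
          + tangentZero A t + 1) / (1 + A t) ^ 2 - 1)
          - (tangentOne A t * tangentZero A t / A t ^ 2 - 1) := by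
        simp only [hg', zero_add, tangentOne, tangentZero]
        field_simp
        ring
      rw [p1]
      refine sub_le_sub_right (mul_le_mul_of_nonneg_left ?_ hcpos.le) _
      refine sub_le_sub_right ?_ _
      have : 0 ≤ (1 - tangentOne A t) * (1 - tangentZero A t) :=
        mul_nonneg (sub_nonneg.2 (h.tangentOne_le ht)) (sub_nonneg.2 (h.tangentZero_le ht))
      calc _ = (2 * (tangentOne A t + tangentZero A t)) / (1 + A t) ^ 2 := by ring
        _ ≤ _ := div_le_div_of_nonneg_right (by nlinarith) (by positivity)
  have comp : ∫ t in Ioo (0 : ℝ) 1, (c * (2 * ((1 + tangentZero A t) / (1 + A t) ^ 2)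
        + 2 * ((1 + tangentOne A t) / (1 + A t) ^ 2) - 4 * (1 / (1 + A t) ^ 2) - 1)
        - (tangentOne A t * tangentZero A t / A t ^ 2 - 1))
      = c * (1 - 4 * I) - (tauIntegral A - 1) := by
    rw [integral_sub, integral_const_mul, integral_sub, integral_sub, integral_add,
      integral_const_mul, integral_const_mul, integral_const_mul, integral_sub, e0, e1]
    · simp only [hI, rhoIntegral, tauIntegral, integral_const, MeasurableSet.univ,
        measureReal_restrict_apply, univ_inter, Real.volume_real_Ioo, smul_eq_mul, sub_zero,
        max_eq_left zero_le_one]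
      ring
    · exact it
    · exact integrableOn_const (by simp)
    · exact i0.const_mul 2
    · exact i1.const_mul 2
    · exact (i0.const_mul 2).add (i1.const_mul 2)
    · exact ir.const_mul 4
    · exact ((i0.const_mul 2).add (i1.const_mul 2)).sub (ir.const_mul 4)
    · exact integrableOn_const (by simp)
    · exact ((((i0.const_mul 2).add (i1.const_mul 2)).sub (ir.const_mul 4)).sub
        (integrableOn_const (by simp))).const_mul c
    · exact it.sub (integrableOn_const (by simp))
  have fin : c * (1 - 4 * I) - (tauIntegral A - 1) ≤ 0 := comp ▸ low.trans main
  have hcm : c * (1 - 2 * I) = 1 := by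
    rw [hc]
    field_simp
  have := mul_le_mul_of_nonneg_right fin hc0.le
  nlinarith

end IsPickands

/-! ### Elementary properties of copulas -/

namespace Copula

variable (C : Copula)

theorem measureReal_fst_preimage {s : Set ℝ} (hs : MeasurableSet s) :
    C.measure.real (Prod.fst ⁻¹' s) = volume.real (s ∩ Icc 0 1) := by
  rw [Measure.real, ← Measure.map_apply measurable_fst hs, C.map_fst, Measure.restrict_apply hs]
  rfl

theorem measureReal_snd_preimage {s : Set ℝ} (hs : MeasurableSet s) :
    C.measure.real (Prod.snd ⁻¹' s) = volume.real (s ∩ Icc 0 1) := by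
  rw [Measure.real, ← Measure.map_apply measurable_snd hs, C.map_snd, Measure.restrict_apply hs]
  rfl

theorem ae_fst_mem : ∀ᵐ p ∂C.measure, p.1 ∈ Icc (0 : ℝ) 1 := by
  have := ae_restrict_mem (μ := (volume : Measure ℝ)) (measurableSet_Icc (a := (0 : ℝ)) (b := 1))
  rw [← C.map_fst] at this
  exact ae_of_ae_map measurable_fst.aemeasurable this

theorem ae_snd_mem : ∀ᵐ p ∂C.measure, p.2 ∈ Icc (0 : ℝ) 1 := by
  have := ae_restrict_mem (μ := (volume : Measure ℝ)) (measurableSet_Icc (a := (0 : ℝ)) (b := 1))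
  rw [← C.map_snd] at this
  exact ae_of_ae_map measurable_snd.aemeasurable this

theorem cdf_nonneg (x y : ℝ) : 0 ≤ C.cdf x y := measureReal_nonneg

theorem cdf_le_one (x y : ℝ) : C.cdf x y ≤ 1 := measureReal_le_one

theorem cdf_mono {x x' y y' : ℝ} (hx : x ≤ x') (hy : y ≤ y') : C.cdf x y ≤ C.cdf x' y' :=
  measureReal_mono (prod_mono (Iic_subset_Iic.2 hx) (Iic_subset_Iic.2 hy))

theorem volume_Iic_inter {x : ℝ} (hx : x ∈ Icc (0 : ℝ) 1) :
    volume.real (Iic x ∩ Icc 0 1) = x := by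
  have : Iic x ∩ Icc 0 1 = Icc 0 x := by
    ext z
    simp only [mem_inter_iff, mem_Iic, mem_Icc]
    exact ⟨fun h => ⟨h.2.1, h.1⟩, fun h => ⟨h.2, h.1, h.2.trans hx.2⟩⟩
  rw [this, Real.volume_real_Icc_of_le hx.1, sub_zero]

theorem cdf_le_left {x : ℝ} (hx : x ∈ Icc (0 : ℝ) 1) (y : ℝ) : C.cdf x y ≤ x := by
  have := C.measureReal_fst_preimage (measurableSet_Iic (a := x))
  rw [volume_Iic_inter hx] at this
  exact (measureReal_mono fun p hp => hp.1).trans_eq this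

theorem cdf_le_right {y : ℝ} (hy : y ∈ Icc (0 : ℝ) 1) (x : ℝ) : C.cdf x y ≤ y := by
  have := C.measureReal_snd_preimage (measurableSet_Iic (a := y))
  rw [volume_Iic_inter hy] at this
  exact (measureReal_mono fun p hp => hp.2).trans_eq this

theorem measureReal_Ioc_prod_Iic {x x' : ℝ} (h : x ≤ x') (y : ℝ) :
    C.measure.real (Ioc x x' ×ˢ Iic y) = C.cdf x' y - C.cdf x y := by
  have : Iic x' ×ˢ Iic y = Iic x ×ˢ Iic y ∪ Ioc x x' ×ˢ Iic y := by
    rw [← union_prod, Iic_union_Ioc_eq_Iic h]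
  unfold cdf
  rw [this, measureReal_union _ (measurableSet_Ioc.prod measurableSet_Iic)]
  · ring
  · exact Set.disjoint_left.2 fun p hp hp' => not_lt.2 hp.1 hp'.1.1

theorem measureReal_Iic_prod_Ioc {y y' : ℝ} (h : y ≤ y') (x : ℝ) :
    C.measure.real (Iic x ×ˢ Ioc y y') = C.cdf x y' - C.cdf x y := by
  have : Iic x ×ˢ Iic y' = Iic x ×ˢ Iic y ∪ Iic x ×ˢ Ioc y y' := by
    rw [← prod_union, Iic_union_Ioc_eq_Iic h]
  unfold cdf
  rw [this, measureReal_union _ (measurableSet_Iic.prod measurableSet_Ioc)]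
  · ring
  · exact Set.disjoint_left.2 fun p hp hp' => not_lt.2 hp.2 hp'.2.1

theorem cdf_sub_le_volume {x x' : ℝ} (h : x ≤ x') (y : ℝ) :
    C.cdf x' y - C.cdf x y ≤ volume.real (Ioc x x' ∩ Icc 0 1) := by
  rw [← C.measureReal_Ioc_prod_Iic h, ← C.measureReal_fst_preimage measurableSet_Ioc]
  exact measureReal_mono fun p hp => hp.1

theorem cdf_sub_le_volume' {y y' : ℝ} (h : y ≤ y') (x : ℝ) :
    C.cdf x y' - C.cdf x y ≤ volume.real (Ioc y y' ∩ Icc 0 1) := by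
  rw [← C.measureReal_Iic_prod_Ioc h, ← C.measureReal_snd_preimage measurableSet_Ioc]
  exact measureReal_mono fun p hp => hp.2

theorem cdf_sub_le {x x' : ℝ} (h : x ≤ x') (y : ℝ) : C.cdf x' y - C.cdf x y ≤ x' - x := by
  refine (C.cdf_sub_le_volume h y).trans ?_
  rw [← Real.volume_real_Ioc_of_le h]
  exact measureReal_mono inter_subset_left (by simp)

theorem cdf_sub_le' {y y' : ℝ} (h : y ≤ y') (x : ℝ) : C.cdf x y' - C.cdf x y ≤ y' - y := by
  refine (C.cdf_sub_le_volume' h x).trans ?_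
  rw [← Real.volume_real_Ioc_of_le h]
  exact measureReal_mono inter_subset_left (by simp)

theorem cdf_rectangle {x x' y y' : ℝ} (hx : x ≤ x') (hy : y ≤ y') :
    C.cdf x y' + C.cdf x' y ≤ C.cdf x y + C.cdf x' y' := by
  have : C.measure.real (Ioc x x' ×ˢ Iic y) ≤ C.measure.real (Ioc x x' ×ˢ Iic y') :=
    measureReal_mono (prod_mono le_rfl (Iic_subset_Iic.2 hy))
  rw [C.measureReal_Ioc_prod_Iic hx, C.measureReal_Ioc_prod_Iic hx] at this
  linarith

theorem cdf_eq_of_one_le {x x' : ℝ} (h1 : 1 ≤ x) (h : x ≤ x') (y : ℝ) :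
    C.cdf x' y = C.cdf x y := by
  refine le_antisymm ?_ (C.cdf_mono h le_rfl)
  have e : Ioc x x' ∩ Icc 0 1 = ∅ := by
    ext z
    simp only [mem_inter_iff, mem_Ioc, mem_Icc, mem_empty_iff_false, iff_false]
    rintro ⟨⟨h2, -⟩, -, h3⟩
    linarith
  have := C.cdf_sub_le_volume h y
  rw [e, measureReal_empty] at this
  linarith

theorem cdf_eq_of_one_le' {y y' : ℝ} (h1 : 1 ≤ y) (h : y ≤ y') (x : ℝ) :
    C.cdf x y' = C.cdf x y := by
  refine le_antisymm ?_ (C.cdf_mono le_rfl h)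
  have e : Ioc y y' ∩ Icc 0 1 = ∅ := by
    ext z
    simp only [mem_inter_iff, mem_Ioc, mem_Icc, mem_empty_iff_false, iff_false]
    rintro ⟨⟨h2, -⟩, -, h3⟩
    linarith
  have := C.cdf_sub_le_volume' h x
  rw [e, measureReal_empty] at this
  linarith

theorem cdf_of_nonpos {x : ℝ} (h : x ≤ 0) (y : ℝ) : C.cdf x y = 0 := by
  refine le_antisymm ?_ (C.cdf_nonneg _ _)
  exact (C.cdf_mono h le_rfl).trans (C.cdf_le_left (by simp) y)

theorem cdf_of_nonpos' {y : ℝ} (h : y ≤ 0) (x : ℝ) : C.cdf x y = 0 := by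
  refine le_antisymm ?_ (C.cdf_nonneg _ _)
  exact (C.cdf_mono le_rfl h).trans (C.cdf_le_right (by simp) x)

theorem cdf_one_right {x : ℝ} (hx : x ∈ Icc (0 : ℝ) 1) : C.cdf x 1 = x := by
  have h1 : C.cdf x 1 = C.measure.real (Prod.fst ⁻¹' Iic x) := by
    refine measureReal_congr ?_
    filter_upwards [C.ae_snd_mem] with p hp
    apply propext
    exact ⟨fun h => h.1, fun h => ⟨h, hp.2⟩⟩
  rw [h1, C.measureReal_fst_preimage measurableSet_Iic, volume_Iic_inter hx]

theorem cdf_one_left {y : ℝ} (hy : y ∈ Icc (0 : ℝ) 1) : C.cdf 1 y = y := by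
  have h1 : C.cdf 1 y = C.measure.real (Prod.snd ⁻¹' Iic y) := by
    refine measureReal_congr ?_
    filter_upwards [C.ae_fst_mem] with p hp
    apply propext
    exact ⟨fun h => h.2, fun h => ⟨hp.2, h⟩⟩
  rw [h1, C.measureReal_snd_preimage measurableSet_Iic, volume_Iic_inter hy]

theorem abs_cdf_sub_le (x x' y y' : ℝ) :
    |C.cdf x y - C.cdf x' y'| ≤ |x - x'| + |y - y'| := by
  have h1 : ∀ a b y, |C.cdf a y - C.cdf b y| ≤ |a - b| := by
    intro a b y
    rcases le_total a b with h | h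
    · rw [abs_sub_comm, abs_sub_comm a, abs_of_nonneg (sub_nonneg.2 (C.cdf_mono h le_rfl)),
        abs_of_nonneg (sub_nonneg.2 h)]
      exact C.cdf_sub_le h y
    · rw [abs_of_nonneg (sub_nonneg.2 (C.cdf_mono h le_rfl)), abs_of_nonneg (sub_nonneg.2 h)]
      exact C.cdf_sub_le h y
  have h2 : ∀ a b x, |C.cdf x a - C.cdf x b| ≤ |a - b| := by
    intro a b x
    rcases le_total a b with h | h
    · rw [abs_sub_comm, abs_sub_comm a, abs_of_nonneg (sub_nonneg.2 (C.cdf_mono le_rfl h)),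
        abs_of_nonneg (sub_nonneg.2 h)]
      exact C.cdf_sub_le' h x
    · rw [abs_of_nonneg (sub_nonneg.2 (C.cdf_mono le_rfl h)), abs_of_nonneg (sub_nonneg.2 h)]
      exact C.cdf_sub_le' h x
  exact (abs_sub_le _ (C.cdf x' y) _).trans (add_le_add (h1 _ _ _) (h2 _ _ _))

theorem continuous_cdf : Continuous fun p : ℝ × ℝ => C.cdf p.1 p.2 := by
  rw [continuous_iff_continuousAt]
  intro q
  unfold ContinuousAt
  rw [tendsto_iff_dist_tendsto_zero]
  have h : Tendsto (fun p : ℝ × ℝ => |p.1 - q.1| + |p.2 - q.2|) (𝓝 q) (𝓝 0) := by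
    have : Continuous fun p : ℝ × ℝ => |p.1 - q.1| + |p.2 - q.2| := by fun_prop
    simpa using this.tendsto q
  exact squeeze_zero (fun _ => dist_nonneg) (fun p => C.abs_cdf_sub_le _ _ _ _) h

theorem measurable_cdf : Measurable fun p : ℝ × ℝ => C.cdf p.1 p.2 := C.continuous_cdf.measurable

theorem integrable_cdf : Integrable (fun p : ℝ × ℝ => C.cdf p.1 p.2) C.measure :=
  Integrable.of_bound C.measurable_cdf.aestronglyMeasurable 1
    (Eventually.of_forall fun p => by
      rw [Real.norm_of_nonneg (C.cdf_nonneg _ _)]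
      exact C.cdf_le_one _ _)

theorem integrable_fst : Integrable (fun p : ℝ × ℝ => p.1) C.measure :=
  Integrable.of_bound measurable_fst.aestronglyMeasurable 1 <| by
    filter_upwards [C.ae_fst_mem] with p hp
    rw [Real.norm_of_nonneg hp.1]
    exact hp.2

theorem integrable_snd : Integrable (fun p : ℝ × ℝ => p.2) C.measure :=
  Integrable.of_bound measurable_snd.aestronglyMeasurable 1 <| by
    filter_upwards [C.ae_snd_mem] with p hp
    rw [Real.norm_of_nonneg hp.1]
    exact hp.2

theorem integral_id_unit : ∫ x in Icc (0 : ℝ) 1, x = 1 / 2 := by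
  rw [integral_Icc_eq_integral_Ioc, ← intervalIntegral.integral_of_le zero_le_one, integral_id]
  norm_num

theorem integral_fst : ∫ p, p.1 ∂C.measure = 1 / 2 := by
  rw [← integral_id_unit, ← C.map_fst]
  exact (integral_map measurable_fst.aemeasurable measurable_id.aestronglyMeasurable).symm

theorem integral_snd : ∫ p, p.2 ∂C.measure = 1 / 2 := by
  rw [← integral_id_unit, ← C.map_snd]
  exact (integral_map measurable_snd.aemeasurable measurable_id.aestronglyMeasurable).symm

theorem kendallTau_le_one : C.kendallTau ≤ 1 := by
  have : ∫ p, C.cdf p.1 p.2 ∂C.measure ≤ ∫ p, p.1 ∂C.measure := by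
    refine integral_mono_ae C.integrable_cdf C.integrable_fst ?_
    filter_upwards [C.ae_fst_mem] with p hp using C.cdf_le_left hp _
  rw [C.integral_fst] at this
  unfold kendallTau
  linarith

/-- Both coordinates have mean `1/2` and dominate `C` almost surely. If `∫ C dμ_C` is also `1/2`,
both equal `C` almost surely, so the measure sits on the diagonal. -/
theorem eq_comonotonic_of_kendallTau (h : C.kendallTau = 1) : C = comonotonic := by
  have hI : ∫ p, C.cdf p.1 p.2 ∂C.measure = 1 / 2 := by
    unfold kendallTau at h
    linarith
  have h1 : (fun p : ℝ × ℝ => p.1 - C.cdf p.1 p.2) =ᵐ[C.measure] 0 := by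
    refine (integral_eq_zero_iff_of_nonneg_ae ?_ (C.integrable_fst.sub C.integrable_cdf)).1 ?_
    · filter_upwards [C.ae_fst_mem] with p hp using sub_nonneg.2 (C.cdf_le_left hp _)
    · exact (integral_sub C.integrable_fst C.integrable_cdf).trans (by
        rw [C.integral_fst, hI, sub_self])
  have h2 : (fun p : ℝ × ℝ => p.2 - C.cdf p.1 p.2) =ᵐ[C.measure] 0 := by
    refine (integral_eq_zero_iff_of_nonneg_ae ?_ (C.integrable_snd.sub C.integrable_cdf)).1 ?_
    · filter_upwards [C.ae_snd_mem] with p hp using sub_nonneg.2 (C.cdf_le_right hp _)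
    · exact (integral_sub C.integrable_snd C.integrable_cdf).trans (by
        rw [C.integral_snd, hI, sub_self])
  have hd : ∀ᵐ p ∂C.measure, p.1 = p.2 := by
    filter_upwards [h1, h2] with p hp hq
    simp only [Pi.zero_apply] at hp hq
    linarith
  refine ext_of_cdf fun x hx y hy => ?_
  rw [comonotonic_cdf hx hy]
  have hm : min x y ∈ Icc (0 : ℝ) 1 := ⟨le_min hx.1 hy.1, (min_le_left _ _).trans hx.2⟩
  rw [← volume_Iic_inter hm, ← C.measureReal_fst_preimage measurableSet_Iic]
  refine measureReal_congr ?_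
  filter_upwards [hd] with p hp
  apply propext
  change (p.1 ≤ x ∧ p.2 ≤ y) ↔ p.1 ≤ min x y
  rw [← hp, le_min_iff]

/-! ### Kendall's tau through partial derivatives -/

/-- Each increment is the `μ_C`-mass of a strip, so the product is the `μ_C ⊗ μ_C`-mass of a section
of `S`. Fubini then measures, for a fixed pair `q`, the rectangle of admissible `p`. -/
theorem integral_cdf_increments {h : ℝ} (hh : 0 < h) :
    ∫ p : ℝ × ℝ, (C.cdf p.1 p.2 - C.cdf (p.1 - h) p.2) * (C.cdf p.1 (p.2 + h) - C.cdf p.1 p.2)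
      = ∫ q, max (q.1.1 + h - max q.1.1 q.2.1) 0 * max (q.2.2 - max q.1.2 (q.2.2 - h)) 0
          ∂(C.measure.prod C.measure) := by
  set S : Set ((ℝ × ℝ) × ((ℝ × ℝ) × (ℝ × ℝ))) :=
    {z | (z.1.1 - h < z.2.1.1 ∧ z.2.1.1 ≤ z.1.1 ∧ z.2.1.2 ≤ z.1.2) ∧
      (z.2.2.1 ≤ z.1.1 ∧ z.1.2 < z.2.2.2 ∧ z.2.2.2 ≤ z.1.2 + h)} with hS
  have hSm : MeasurableSet S := by
    simp only [hS, measurableSet_setOfPred]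
    refine ((measurableSet_setOfPred.1 (measurableSet_lt ?_ ?_)).and ((measurableSet_setOfPred.1 (measurableSet_le ?_ ?_)).and (measurableSet_setOfPred.1 (measurableSet_le ?_ ?_)))).and
      ((measurableSet_setOfPred.1 (measurableSet_le ?_ ?_)).and ((measurableSet_setOfPred.1 (measurableSet_lt ?_ ?_)).and (measurableSet_setOfPred.1 (measurableSet_le ?_ ?_)))) <;> fun_prop
  have e1 : ∀ p : ℝ × ℝ, (C.measure.prod C.measure) (Prod.mk p ⁻¹' S)
      = C.measure (Ioc (p.1 - h) p.1 ×ˢ Iic p.2) * C.measure (Iic p.1 ×ˢ Ioc p.2 (p.2 + h)) := by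
    intro p
    rw [← Measure.prod_prod]
    congr 1
    ext q
    simp only [hS, mem_preimage, mem_ofPred_eq, mem_prod, mem_Ioc, mem_Iic]
    tauto
  have e2 : ∀ q : (ℝ × ℝ) × (ℝ × ℝ), volume ((fun p => (p, q)) ⁻¹' S)
      = ENNReal.ofReal (q.1.1 + h - max q.1.1 q.2.1)
        * ENNReal.ofReal (q.2.2 - max q.1.2 (q.2.2 - h)) := by
    intro q
    rw [← Real.volume_Ico, ← Real.volume_Ico, Measure.volume_eq_prod, ← Measure.prod_prod]
    congr 1
    ext p
    simp only [hS, mem_preimage, mem_ofPred_eq, mem_prod, mem_Ico, max_le_iff]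
    constructor
    · rintro ⟨⟨h1, h2, h3⟩, h4, h5, h6⟩
      exact ⟨⟨⟨h2, h4⟩, by linarith⟩, ⟨h3, by linarith⟩, h5⟩
    · rintro ⟨⟨⟨h2, h4⟩, h1⟩, ⟨h3, h6⟩, h5⟩
      exact ⟨⟨by linarith, h2, h3⟩, h4, h5, by linarith⟩
  have e3 := (Measure.prod_apply (μ := (volume : Measure (ℝ × ℝ)))
    (ν := C.measure.prod C.measure) hSm).symm.trans (Measure.prod_apply_symm hSm)
  have m1 := measurable_measure_prodMk_left (ν := C.measure.prod C.measure) hSm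
  have m2 := measurable_measure_prodMk_right (μ := (volume : Measure (ℝ × ℝ))) hSm
  simp only [e1, e2] at e3 m1 m2
  have e4 := congrArg ENNReal.toReal e3
  rw [← integral_toReal m1.aemeasurable (Eventually.of_forall fun p =>
      ENNReal.mul_lt_top (measure_lt_top _ _) (measure_lt_top _ _)),
    ← integral_toReal m2.aemeasurable (Eventually.of_forall fun p =>
      ENNReal.mul_lt_top ENNReal.ofReal_lt_top ENNReal.ofReal_lt_top)] at e4
  simp only [ENNReal.toReal_mul, ENNReal.toReal_ofReal'] at e4
  rw [← e4]
  congr 1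
  ext p
  rw [← C.measureReal_Ioc_prod_Iic (by linarith), ← C.measureReal_Iic_prod_Ioc (by linarith)]
  rfl

theorem measureReal_Iic_prod_Ioi {x : ℝ} (hx : x ∈ Icc (0 : ℝ) 1) (y : ℝ) :
    C.measure.real (Iic x ×ˢ Ioi y) = x - C.cdf x y := by
  have h1 : Prod.fst ⁻¹' Iic x = (Iic x ×ˢ Iic y ∪ Iic x ×ˢ Ioi y : Set (ℝ × ℝ)) := by
    rw [← prod_union, Iic_union_Ioi, prod_univ]
  have h2 := C.measureReal_fst_preimage (measurableSet_Iic (a := x))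
  rw [volume_Iic_inter hx, h1, measureReal_union _ (measurableSet_Iic.prod measurableSet_Ioi)]
    at h2
  · unfold cdf
    linarith
  · exact Set.disjoint_left.2 fun p hp hp' => (not_lt.2 (mem_Iic.1 hp.2)) (mem_Ioi.1 hp'.2)

/-- After division by `h²` the rectangle areas are at most `1` and converge to the indicator of `D`.
For fixed first point `(x, y)` the section of `D` has mass `x - C(x,y)`, and `x` has mean `1/2`. -/
theorem tendsto_integral_increments :
    Tendsto (fun h => ∫ p : ℝ × ℝ, (C.cdf p.1 p.2 - C.cdf (p.1 - h) p.2) / h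
        * ((C.cdf p.1 (p.2 + h) - C.cdf p.1 p.2) / h)) (𝓝[>] 0)
      (𝓝 (1 / 2 - ∫ p, C.cdf p.1 p.2 ∂C.measure)) := by
  set D : Set ((ℝ × ℝ) × (ℝ × ℝ)) := {q | q.2.1 ≤ q.1.1 ∧ q.1.2 < q.2.2} with hD
  have hDm : MeasurableSet D := by
    simp only [hD, measurableSet_setOfPred]
    refine (measurableSet_setOfPred.1 (measurableSet_le ?_ ?_)).and (measurableSet_setOfPred.1 (measurableSet_lt ?_ ?_)) <;> fun_prop
  have lim : ∫ q, D.indicator (fun _ => (1 : ℝ)) q ∂(C.measure.prod C.measure)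
      = 1 / 2 - ∫ p, C.cdf p.1 p.2 ∂C.measure := by
    rw [integral_prod _ ((integrable_const _).indicator hDm), ← C.integral_fst,
      ← integral_sub C.integrable_fst C.integrable_cdf]
    refine integral_congr_ae ?_
    filter_upwards [C.ae_fst_mem] with p hp
    rw [← C.measureReal_Iic_prod_Ioi hp, ← integral_indicator_one
      (measurableSet_Iic.prod measurableSet_Ioi)]
    rfl
  rw [← lim]
  have step : Tendsto (fun h => ∫ q, max (q.1.1 + h - max q.1.1 q.2.1) 0 / h
      * (max (q.2.2 - max q.1.2 (q.2.2 - h)) 0 / h) ∂(C.measure.prod C.measure)) (𝓝[>] 0)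
      (𝓝 (∫ q, D.indicator (fun _ => (1 : ℝ)) q ∂(C.measure.prod C.measure))) := by
    refine tendsto_integral_filter_of_dominated_convergence (fun _ => 1) ?_ ?_
      (integrable_const _) ?_
    · refine Eventually.of_forall fun h => Measurable.aestronglyMeasurable ?_
      fun_prop
    · filter_upwards [self_mem_nhdsWithin] with h hh
      rw [mem_Ioi] at hh
      refine Eventually.of_forall fun q => ?_
      have a1 : 0 ≤ max (q.1.1 + h - max q.1.1 q.2.1) 0 / h := by positivity
      have a2 : 0 ≤ max (q.2.2 - max q.1.2 (q.2.2 - h)) 0 / h := by positivity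
      rw [Real.norm_of_nonneg (mul_nonneg a1 a2)]
      refine mul_le_one₀ ?_ a2 ?_
      · rw [div_le_one hh]
        exact max_le (by linarith [le_max_left q.1.1 q.2.1]) hh.le
      · rw [div_le_one hh]
        exact max_le (by linarith [le_max_right q.1.2 (q.2.2 - h)]) hh.le
    · refine Eventually.of_forall fun q => ?_
      refine Tendsto.congr' (f₁ := fun _ => D.indicator (fun _ => (1 : ℝ)) q) ?_ tendsto_const_nhds
      by_cases h1 : q.2.1 ≤ q.1.1
      · by_cases h2 : q.1.2 < q.2.2
        · filter_upwards [Ioo_mem_nhdsGT (sub_pos.2 h2)] with h hh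
          have hq : q ∈ D := ⟨h1, h2⟩
          rw [indicator_of_mem hq, max_eq_left h1, max_eq_right (by linarith [hh.2] :
            q.1.2 ≤ q.2.2 - h), add_sub_cancel_left, sub_sub_cancel, max_eq_left hh.1.le,
            div_self hh.1.ne', one_mul]
        · refine Eventually.of_forall fun h => ?_
          have hq : q ∉ D := fun hq => h2 hq.2
          have hz : max (q.2.2 - max q.1.2 (q.2.2 - h)) 0 = 0 :=
            max_eq_right (by linarith [le_max_left q.1.2 (q.2.2 - h)])
          simp [indicator_of_notMem hq, hz]
      · filter_upwards [Ioo_mem_nhdsGT (sub_pos.2 (not_le.1 h1))] with h hh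
        have hq : q ∉ D := fun hq => h1 hq.1
        rw [indicator_of_notMem hq, max_eq_right (not_le.1 h1).le,
          max_eq_right (by linarith [hh.2] : q.1.1 + h - q.2.1 ≤ 0)]
        simp
  refine step.congr' ?_
  filter_upwards [self_mem_nhdsWithin] with h hh
  have := C.integral_cdf_increments hh
  calc _ = (1 / h / h) * ∫ q, max (q.1.1 + h - max q.1.1 q.2.1) 0
            * max (q.2.2 - max q.1.2 (q.2.2 - h)) 0 ∂(C.measure.prod C.measure) := by
        rw [← integral_const_mul]
        congr 1
        ext q
        ring
    _ = _ := by
        rw [← this, ← integral_const_mul]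
        congr 1
        ext q
        ring

/-- One-sided derivatives suffice because the increments in `tendsto_integral_increments` look left
in `x` and right in `y`; no absolute continuity of `μ_C` is needed. -/
theorem integral_cdf_eq_of_hasDerivWithinAt {F G : ℝ × ℝ → ℝ}
    (hF : ∀ x ∈ Ioo (0 : ℝ) 1, ∀ y ∈ Ioo (0 : ℝ) 1,
      HasDerivWithinAt (fun z => C.cdf z y) (F (x, y)) (Iio x) x)
    (hG : ∀ x ∈ Ioo (0 : ℝ) 1, ∀ y ∈ Ioo (0 : ℝ) 1,
      HasDerivWithinAt (fun z => C.cdf x z) (G (x, y)) (Ioi y) y) :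
    IntegrableOn (fun p => F p * G p) (Ioo 0 1 ×ˢ Ioo 0 1) ∧
    ∫ p, C.cdf p.1 p.2 ∂C.measure
      = 1 / 2 - ∫ p in Ioo (0 : ℝ) 1 ×ˢ Ioo (0 : ℝ) 1, F p * G p := by
  set Φ : ℝ → ℝ × ℝ → ℝ := fun h p => (C.cdf p.1 p.2 - C.cdf (p.1 - h) p.2) / h
        * ((C.cdf p.1 (p.2 + h) - C.cdf p.1 p.2) / h) with hΦ
  set Q : Set (ℝ × ℝ) := Ioo 0 1 ×ˢ Ioo 0 1 with hQ
  have hQm : MeasurableSet Q := measurableSet_Ioo.prod measurableSet_Ioo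
  -- For `h < 1` the increments vanish outside this box, whose indicator is the dominating function.
  set B : Set (ℝ × ℝ) := Icc 0 2 ×ˢ Icc (-1) 1 with hB
  have hBm : MeasurableSet B := measurableSet_Icc.prod measurableSet_Icc
  have hmeas : ∀ h, Measurable (Φ h) := by
    intro h
    have h1 := C.measurable_cdf
    have h2 : Measurable fun p : ℝ × ℝ => C.cdf (p.1 - h) p.2 :=
      h1.comp (f := fun p : ℝ × ℝ => (p.1 - h, p.2)) (by fun_prop)
    have h3 : Measurable fun p : ℝ × ℝ => C.cdf p.1 (p.2 + h) :=
      h1.comp (f := fun p : ℝ × ℝ => (p.1, p.2 + h)) (by fun_prop)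
    exact ((h1.sub h2).div_const h).mul ((h3.sub h1).div_const h)
  have hbd : ∀ h ∈ Ioo (0 : ℝ) 1, ∀ p, 0 ≤ Φ h p ∧ Φ h p ≤ 1 := by
    intro h hh p
    have a1 : 0 ≤ (C.cdf p.1 p.2 - C.cdf (p.1 - h) p.2) / h :=
      div_nonneg (sub_nonneg.2 (C.cdf_mono (by linarith [hh.1]) le_rfl)) hh.1.le
    have a2 : 0 ≤ (C.cdf p.1 (p.2 + h) - C.cdf p.1 p.2) / h :=
      div_nonneg (sub_nonneg.2 (C.cdf_mono le_rfl (by linarith [hh.1]))) hh.1.le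
    refine ⟨mul_nonneg a1 a2, mul_le_one₀ ?_ a2 ?_⟩
    · rw [div_le_one hh.1]
      exact (C.cdf_sub_le (by linarith [hh.1]) _).trans (by linarith)
    · rw [div_le_one hh.1]
      exact (C.cdf_sub_le' (by linarith [hh.1]) _).trans (by linarith)
  have zl : ∀ h ∈ Ioo (0 : ℝ) 1, ∀ p : ℝ × ℝ, p.1 < 0 → Φ h p = 0 := by
    intro h hh p hp
    simp [hΦ, C.cdf_of_nonpos hp.le, C.cdf_of_nonpos (by linarith [hh.1] : p.1 - h ≤ 0)]
  have zr : ∀ h ∈ Ioo (0 : ℝ) 1, ∀ p : ℝ × ℝ, 1 ≤ p.1 - h → Φ h p = 0 := by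
    intro h hh p hp
    simp [hΦ, C.cdf_eq_of_one_le hp (by linarith [hh.1] : p.1 - h ≤ p.1)]
  have zd : ∀ h ∈ Ioo (0 : ℝ) 1, ∀ p : ℝ × ℝ, p.2 + h ≤ 0 → Φ h p = 0 := by
    intro h hh p hp
    simp [hΦ, C.cdf_of_nonpos' hp, C.cdf_of_nonpos' (by linarith [hh.1] : p.2 ≤ 0)]
  have zu : ∀ h ∈ Ioo (0 : ℝ) 1, ∀ p : ℝ × ℝ, 1 ≤ p.2 → Φ h p = 0 := by
    intro h hh p hp
    simp [hΦ, C.cdf_eq_of_one_le' hp (by linarith [hh.1] : p.2 ≤ p.2 + h)]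
  have small : ∀ᶠ h : ℝ in 𝓝[>] 0, h ∈ Ioo (0 : ℝ) 1 := Ioo_mem_nhdsGT zero_lt_one
  have limQ : ∀ p ∈ Q, Tendsto (fun h => Φ h p) (𝓝[>] 0) (𝓝 (F p * G p)) := by
    rintro ⟨x, y⟩ ⟨hx, hy⟩
    refine Tendsto.mul ?_ ?_
    · have h1 := (hasDerivWithinAt_iff_tendsto_slope' (by simp)).1 (hF x hx y hy)
      have h2 : Tendsto (fun h : ℝ => x - h) (𝓝[>] 0) (𝓝[<] x) := by
        refine tendsto_nhdsWithin_iff.2 ⟨?_, ?_⟩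
        · have : Continuous fun h : ℝ => x - h := by fun_prop
          exact (this.tendsto' 0 _ (by simp)).mono_left inf_le_left
        · filter_upwards [self_mem_nhdsWithin] with h hh
          simpa using hh
      refine (h1.comp h2).congr fun h => ?_
      simp only [Function.comp, slope_def_field]
      rw [sub_sub_cancel_left, div_neg, ← neg_div, neg_sub]
    · have h1 := (hasDerivWithinAt_iff_tendsto_slope' (by simp)).1 (hG x hx y hy)
      have h2 : Tendsto (fun h : ℝ => y + h) (𝓝[>] 0) (𝓝[>] y) := by
        refine tendsto_nhdsWithin_iff.2 ⟨?_, ?_⟩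
        · have : Continuous fun h : ℝ => y + h := by fun_prop
          exact (this.tendsto' 0 _ (by simp)).mono_left inf_le_left
        · filter_upwards [self_mem_nhdsWithin] with h hh
          simpa using hh
      refine (h1.comp h2).congr fun h => ?_
      simp only [Function.comp, slope_def_field]
      rw [add_sub_cancel_left]
  -- Off the closed square the quotients vanish for small `h`. On its edges nothing is claimed, and
  -- the edges form a null set.
  have aeQ : (Q : Set (ℝ × ℝ)) =ᵐ[volume] (Icc 0 1 ×ˢ Icc 0 1 : Set (ℝ × ℝ)) := by
    rw [Measure.volume_eq_prod]
    exact Measure.set_prod_ae_eq Ioo_ae_eq_Icc Ioo_ae_eq_Icc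
  have dct : Tendsto (fun h => ∫ p, Φ h p) (𝓝[>] 0) (𝓝 (∫ p, Q.indicator (fun p => F p * G p) p)) := by
    refine tendsto_integral_filter_of_dominated_convergence (B.indicator fun _ => 1) ?_ ?_ ?_ ?_
    · exact Eventually.of_forall fun h => (hmeas h).aestronglyMeasurable
    · filter_upwards [small] with h hh
      refine Eventually.of_forall fun p => ?_
      rw [Real.norm_of_nonneg (hbd h hh p).1]
      by_cases hp : p ∈ B
      · rw [indicator_of_mem hp]
        exact (hbd h hh p).2
      · rw [indicator_of_notMem hp]
        refine le_of_eq ?_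
        by_contra hne
        refine hp ⟨⟨?_, ?_⟩, ?_, ?_⟩
        · by_contra hc
          exact hne (zl h hh p (not_le.1 hc))
        · by_contra hc
          exact hne (zr h hh p (by linarith [hh.2]))
        · by_contra hc
          exact hne (zd h hh p (by linarith [hh.2]))
        · by_contra hc
          exact hne (zu h hh p (by linarith))
    · refine (integrable_indicator_iff hBm).2 (integrableOn_const ?_)
      rw [hB, Measure.volume_eq_prod, Measure.prod_prod]
      exact (ENNReal.mul_lt_top (by simp) (by simp)).ne
    · filter_upwards [aeQ] with p hp
      by_cases hpQ : p ∈ Q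
      · rw [indicator_of_mem hpQ]
        exact limQ p hpQ
      · rw [indicator_of_notMem hpQ]
        have hpI : p ∉ (Icc 0 1 ×ˢ Icc 0 1 : Set (ℝ × ℝ)) := fun h => hpQ ((iff_of_eq hp).2 h)
        refine Tendsto.congr' (f₁ := fun _ => 0) ?_ tendsto_const_nhds
        by_cases c1 : p.1 < 0
        · filter_upwards [small] with h hh using (zl h hh p c1).symm
        by_cases c2 : 1 < p.1
        · filter_upwards [small, Ioo_mem_nhdsGT (sub_pos.2 c2)] with h hh hh'
          exact (zr h hh p (by linarith [hh'.2])).symm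
        by_cases c3 : p.2 < 0
        · filter_upwards [small, Ioo_mem_nhdsGT (neg_pos.2 c3)] with h hh hh'
          exact (zd h hh p (by linarith [hh'.2])).symm
        by_cases c4 : 1 ≤ p.2
        · filter_upwards [small] with h hh using (zu h hh p c4).symm
        push Not at c1 c2 c3 c4
        exact absurd ⟨⟨c1, c2⟩, c3, c4.le⟩ hpI
  constructor
  · have hm : AEStronglyMeasurable (fun p => F p * G p) (volume.restrict Q) := by
      refine aestronglyMeasurable_of_tendsto_ae (𝓝[>] (0 : ℝ)) (f := Φ)
        (fun h => (hmeas h).aestronglyMeasurable) ?_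
      exact (ae_restrict_iff' hQm).2 (Eventually.of_forall limQ)
    have hfin : volume Q < ⊤ := by
      rw [hQ, Measure.volume_eq_prod, Measure.prod_prod]
      exact ENNReal.mul_lt_top (by simp) (by simp)
    have : IsFiniteMeasure (volume.restrict Q) := ⟨by simpa using hfin⟩
    refine Integrable.of_bound hm 1 ((ae_restrict_iff' hQm).2 (Eventually.of_forall fun p hp => ?_))
    refine le_of_tendsto (limQ p hp).norm ?_
    filter_upwards [small] with h hh
    rw [Real.norm_of_nonneg (hbd h hh p).1]
    exact (hbd h hh p).2
  · have := tendsto_nhds_unique dct C.tendsto_integral_increments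
    rw [integral_indicator hQm] at this
    linarith

end Copula

/-! ### Logarithmic polar coordinates on the unit square -/

theorem integral_id_mul_exp_neg_mul {k : ℝ} (hk : 0 < k) :
    ∫ r in Ioi (0 : ℝ), r * Real.exp (-(k * r)) = 1 / k ^ 2 := by
  have := Real.integral_rpow_mul_exp_neg_mul_Ioi (a := 2) (r := k) two_pos hk
  have hg : Real.Gamma 2 = 1 := Real.Gamma_two
  rw [hg, mul_one, Real.rpow_two, div_pow, one_pow] at this
  rw [← this]
  refine setIntegral_congr_fun measurableSet_Ioi fun r _ => ?_
  norm_num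

/-- The parametrization of the open unit square by the curves `x ^ (1 - t) = y ^ t`. -/
noncomputable def squareParam (q : ℝ × ℝ) : ℝ × ℝ :=
  (Real.exp (-(q.2 * q.1)), Real.exp (-(q.2 * (1 - q.1))))

theorem log_div_log_mul_exp {t r : ℝ} (hr : 0 < r) :
    Real.log (Real.exp (-(r * t)))
      / Real.log (Real.exp (-(r * t)) * Real.exp (-(r * (1 - t)))) = t := by
  rw [← Real.exp_add, Real.log_exp, Real.log_exp]
  have : -(r * t) + -(r * (1 - t)) = -r := by ring
  rw [this, neg_div_neg_eq, mul_div_cancel_left₀ _ hr.ne']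

theorem squareParam_image :
    squareParam '' (Ioo 0 1 ×ˢ Ioi 0) = Ioo (0 : ℝ) 1 ×ˢ Ioo (0 : ℝ) 1 := by
  ext ⟨x, y⟩
  constructor
  · rintro ⟨⟨t, r⟩, ⟨ht, hr⟩, h⟩
    rw [← h]
    simp only [mem_Ioi] at hr ht
    refine ⟨⟨Real.exp_pos _, ?_⟩, Real.exp_pos _, ?_⟩ <;>
      simp only [squareParam, Real.exp_lt_one_iff, neg_lt_zero]
    · exact mul_pos hr ht.1
    · exact mul_pos hr (sub_pos.2 ht.2)
  · rintro ⟨hx, hy⟩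
    have hlx := Real.log_neg hx.1 hx.2
    have hly := Real.log_neg hy.1 hy.2
    have hs : 0 < -Real.log x + -Real.log y := by linarith
    refine ⟨(-Real.log x / (-Real.log x + -Real.log y), -Real.log x + -Real.log y),
      ⟨⟨by apply div_pos <;> linarith, ?_⟩, hs⟩, ?_⟩
    · rw [div_lt_one hs]
      linarith
    · simp only [squareParam]
      rw [mul_sub, mul_div_cancel₀ _ hs.ne']
      ext
      · simp [Real.exp_log hx.1]
      · simp [Real.exp_log hy.1]

theorem squareParam_injOn : InjOn squareParam (Ioo 0 1 ×ˢ Ioi 0) := by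
  rintro ⟨t, r⟩ ⟨-, hr⟩ ⟨t', r'⟩ ⟨-, hr'⟩ h
  simp only [squareParam, Prod.mk.injEq, Real.exp_eq_exp, neg_inj] at h
  simp only [mem_Ioi] at hr hr'
  have h1 : r = r' := by linarith [h.1, h.2]
  subst h1
  have h2 := mul_left_cancel₀ hr.ne' h.1
  rw [h2]

/-- The derivative of `squareParam`. -/
noncomputable def squareParamFDeriv (q : ℝ × ℝ) : ℝ × ℝ →L[ℝ] ℝ × ℝ :=
  (Matrix.toLin (.finTwoProd ℝ) (.finTwoProd ℝ)
    !![-q.2 * Real.exp (-(q.2 * q.1)), -q.1 * Real.exp (-(q.2 * q.1));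
      q.2 * Real.exp (-(q.2 * (1 - q.1))),
      -(1 - q.1) * Real.exp (-(q.2 * (1 - q.1)))]).toContinuousLinearMap

theorem hasFDerivAt_squareParam (q : ℝ × ℝ) :
    HasFDerivAt squareParam (squareParamFDeriv q) q := by
  unfold squareParamFDeriv
  rw [Matrix.toLin_finTwoProd_toContinuousLinearMap]
  have h1 := ((hasFDerivAt_snd (𝕜 := ℝ) (p := q)).mul (hasFDerivAt_fst (p := q))).neg.exp
  have h2 := ((hasFDerivAt_snd (𝕜 := ℝ) (p := q)).mul
    ((hasFDerivAt_fst (p := q)).const_sub 1)).neg.exp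
  refine (h1.prodMk h2).congr_fderiv ?_
  ext <;> simp <;> ring

theorem det_squareParamFDeriv (q : ℝ × ℝ) :
    (squareParamFDeriv q).det = q.2 * Real.exp (-q.2) := by
  have : Real.exp (-q.2) = Real.exp (-(q.2 * q.1)) * Real.exp (-(q.2 * (1 - q.1))) := by
    rw [← Real.exp_add]
    congr 1
    ring
  rw [this]
  unfold squareParamFDeriv
  simp only [LinearMap.det_toContinuousLinearMap, LinearMap.det_toLin, Matrix.det_fin_two_of]
  ring

/-- Change of variables with Jacobian `r e^{-r}`, followed by Fubini. The angle `t` is the argument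
of the Pickands function. -/
theorem setIntegral_unitSquare {F : ℝ × ℝ → ℝ}
    (hF : IntegrableOn F (Ioo (0 : ℝ) 1 ×ˢ Ioo (0 : ℝ) 1)) :
    ∫ p in Ioo (0 : ℝ) 1 ×ˢ Ioo (0 : ℝ) 1, F p
      = ∫ t in Ioo (0 : ℝ) 1, ∫ r in Ioi (0 : ℝ), r * Real.exp (-r) * F (squareParam (t, r)) := by
  have hm : MeasurableSet (Ioo (0 : ℝ) 1 ×ˢ Ioi (0 : ℝ)) := measurableSet_Ioo.prod measurableSet_Ioi
  have hd : ∀ q ∈ Ioo (0 : ℝ) 1 ×ˢ Ioi (0 : ℝ),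
      HasFDerivWithinAt squareParam (squareParamFDeriv q) (Ioo (0 : ℝ) 1 ×ˢ Ioi (0 : ℝ)) q :=
    fun q _ => (hasFDerivAt_squareParam q).hasFDerivWithinAt
  have e : ∀ q ∈ Ioo (0 : ℝ) 1 ×ˢ Ioi (0 : ℝ),
      |(squareParamFDeriv q).det| • F (squareParam q)
        = q.2 * Real.exp (-q.2) * F (squareParam q) := by
    rintro q ⟨-, hq⟩
    rw [det_squareParamFDeriv, abs_of_nonneg (mul_nonneg (le_of_lt hq) (Real.exp_pos _).le),
      smul_eq_mul]
  rw [← squareParam_image] at hF ⊢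
  rw [integrableOn_image_iff_integrableOn_abs_det_fderiv_smul volume hm hd squareParam_injOn] at hF
  rw [integral_image_eq_integral_abs_det_fderiv_smul volume hm hd squareParam_injOn,
    setIntegral_congr_fun hm e, Measure.volume_eq_prod, setIntegral_prod]
  rw [← Measure.volume_eq_prod]
  exact (integrableOn_congr_fun e hm).1 hF

theorem unitSquare_ae_eq : (Icc (0 : ℝ) 1 ×ˢ Icc (0 : ℝ) 1 : Set (ℝ × ℝ)) =ᵐ[volume]
    (Ioo (0 : ℝ) 1 ×ˢ Ioo (0 : ℝ) 1 : Set (ℝ × ℝ)) := by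
  rw [Measure.volume_eq_prod]
  exact Measure.set_prod_ae_eq Ioo_ae_eq_Icc.symm Ioo_ae_eq_Icc.symm

/-! ### Rho and tau of an induced copula -/

namespace Copula

variable {C : Copula} {A : ℝ → ℝ}

theorem log_ratio_mem {x y : ℝ} (hx : x ∈ Ioo (0 : ℝ) 1) (hy : y ∈ Ioo (0 : ℝ) 1) :
    Real.log x / Real.log (x * y) ∈ Ioo (0 : ℝ) 1 := by
  have hlx := Real.log_neg hx.1 hx.2
  have hly := Real.log_neg hy.1 hy.2
  rw [Real.log_mul hx.1.ne' hy.1.ne']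
  refine ⟨div_pos_of_neg_of_neg hlx (by linarith), ?_⟩
  rw [div_lt_one_of_neg (by linarith)]
  linarith

theorem IsInducedBy.cdf_eq_exp (h : C.IsInducedBy A) {x y : ℝ} (hx : x ∈ Ioo (0 : ℝ) 1)
    (hy : y ∈ Ioo (0 : ℝ) 1) :
    C.cdf x y = Real.exp (Real.log (x * y) * A (Real.log x / Real.log (x * y))) := by
  rw [h x hx y hy, Real.rpow_def_of_pos (mul_pos hx.1 hy.1)]

theorem IsInducedBy.cdf_squareParam (h : C.IsInducedBy A) {t r : ℝ} (ht : t ∈ Ioo (0 : ℝ) 1)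
    (hr : 0 < r) :
    C.cdf (squareParam (t, r)).1 (squareParam (t, r)).2 = Real.exp (-(A t * r)) := by
  have hm : squareParam (t, r) ∈ Ioo (0 : ℝ) 1 ×ˢ Ioo (0 : ℝ) 1 := by
    rw [← squareParam_image]
    exact mem_image_of_mem _ ⟨ht, hr⟩
  rw [h.cdf_eq_exp hm.1 hm.2]
  simp only [squareParam]
  rw [log_div_log_mul_exp hr, ← Real.exp_add, Real.log_exp]
  congr 1
  ring

/-- Decreasing `x` increases `log x / log (x y)`, so a left derivative in `x` meets the right
derivative of `A`. -/
theorem IsInducedBy.hasDerivWithinAt_left (h : C.IsInducedBy A) (hA : IsPickands A) {x y : ℝ}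
    (hx : x ∈ Ioo (0 : ℝ) 1) (hy : y ∈ Ioo (0 : ℝ) 1) :
    HasDerivWithinAt (fun z => C.cdf z y)
      (C.cdf x y * IsPickands.tangentOne A (Real.log x / Real.log (x * y)) / x) (Iio x) x := by
  have hlx := Real.log_neg hx.1 hx.2
  have hly := Real.log_neg hy.1 hy.2
  have hl : Real.log (x * y) = Real.log x + Real.log y := Real.log_mul hx.1.ne' hy.1.ne'
  have hln : Real.log (x * y) ≠ 0 := by rw [hl]; linarith
  have d1 : HasDerivAt (fun z => Real.log (z * y)) (1 / x) x := by
    refine (((hasDerivAt_id' x).mul_const y).log (mul_pos hx.1 hy.1).ne').congr_deriv ?_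
    have := hx.1.ne'
    have := hy.1.ne'
    field_simp
  have d2 := ((Real.hasDerivAt_log hx.1.ne').div d1 hln).hasDerivWithinAt (s := Ioo 0 x)
  have maps : MapsTo (fun z => Real.log z / Real.log (z * y)) (Ioo 0 x)
      (Ioi (Real.log x / Real.log (x * y))) := by
    intro z hz
    have hz' := Real.log_lt_log hz.1 hz.2
    change Real.log x / Real.log (x * y) < Real.log z / Real.log (z * y)
    rw [hl, Real.log_mul hz.1.ne' hy.1.ne', ← neg_div_neg_eq (Real.log x),
      ← neg_div_neg_eq (Real.log z), div_lt_div_iff₀ (by linarith) (by linarith)]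
    nlinarith
  have d3 := HasDerivWithinAt.comp x (hA.hasDerivWithinAt (log_ratio_mem hx hy)) d2 maps
  have d4 := (d1.hasDerivWithinAt.mul d3).exp
  have d5 : HasDerivWithinAt (fun z => C.cdf z y)
      (C.cdf x y * IsPickands.tangentOne A (Real.log x / Real.log (x * y)) / x) (Ioo 0 x) x := by
    refine (d4.congr (fun z hz => ?_) ?_).congr_deriv ?_
    · exact h.cdf_eq_exp ⟨hz.1, hz.2.trans hx.2⟩ hy
    · exact h.cdf_eq_exp hx hy
    · rw [h.cdf_eq_exp hx hy]
      simp only [IsPickands.tangentOne, Function.comp, Pi.mul_apply, Pi.div_apply]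
      rw [mul_div_assoc]
      congr 1
      have := hx.1.ne'
      field_simp
  exact d5.mono_of_mem_nhdsWithin (Ioo_mem_nhdsLT hx.1)

/-- Increasing `y` also increases `log x / log (x y)`, so both partial derivatives involve the same
one-sided slope of `A`, even at its kinks. -/
theorem IsInducedBy.hasDerivWithinAt_right (h : C.IsInducedBy A) (hA : IsPickands A) {x y : ℝ}
    (hx : x ∈ Ioo (0 : ℝ) 1) (hy : y ∈ Ioo (0 : ℝ) 1) :
    HasDerivWithinAt (fun z => C.cdf x z)
      (C.cdf x y * IsPickands.tangentZero A (Real.log x / Real.log (x * y)) / y) (Ioi y) y := by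
  have hlx := Real.log_neg hx.1 hx.2
  have hly := Real.log_neg hy.1 hy.2
  have hl : Real.log (x * y) = Real.log x + Real.log y := Real.log_mul hx.1.ne' hy.1.ne'
  have hln : Real.log (x * y) ≠ 0 := by rw [hl]; linarith
  have d1 : HasDerivAt (fun z => Real.log (x * z)) (1 / y) y := by
    refine (((hasDerivAt_id' y).const_mul x).log (mul_pos hx.1 hy.1).ne').congr_deriv ?_
    have := hx.1.ne'
    have := hy.1.ne'
    field_simp
  have d2 := ((hasDerivAt_const y (Real.log x)).div d1 hln).hasDerivWithinAt (s := Ioo y 1)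
  have maps : MapsTo (fun z => Real.log x / Real.log (x * z)) (Ioo y 1)
      (Ioi (Real.log x / Real.log (x * y))) := by
    intro z hz
    have hz0 := hy.1.trans hz.1
    have hz' := Real.log_lt_log hy.1 hz.1
    have hz1 := Real.log_neg hz0 hz.2
    change Real.log x / Real.log (x * y) < Real.log x / Real.log (x * z)
    rw [hl, Real.log_mul hx.1.ne' hz0.ne',
      ← neg_div_neg_eq _ (Real.log x + Real.log y), ← neg_div_neg_eq _ (Real.log x + Real.log z),
      div_lt_div_iff₀ (by linarith) (by linarith)]
    nlinarith
  have d3 := HasDerivWithinAt.comp y (hA.hasDerivWithinAt (log_ratio_mem hx hy)) d2 maps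
  have d4 := (d1.hasDerivWithinAt.mul d3).exp
  have d5 : HasDerivWithinAt (fun z => C.cdf x z)
      (C.cdf x y * IsPickands.tangentZero A (Real.log x / Real.log (x * y)) / y) (Ioo y 1) y := by
    refine (d4.congr (fun z hz => ?_) ?_).congr_deriv ?_
    · exact h.cdf_eq_exp hx ⟨hy.1.trans hz.1, hz.2⟩
    · exact h.cdf_eq_exp hx hy
    · rw [h.cdf_eq_exp hx hy]
      simp only [IsPickands.tangentZero, Function.comp, Pi.mul_apply, Pi.div_apply]
      rw [mul_div_assoc]
      congr 1
      have := hy.1.ne'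
      field_simp
      ring
  exact d5.mono_of_mem_nhdsWithin (Ioo_mem_nhdsGT hy.2)

theorem IsInducedBy.spearmanRho_eq (h : C.IsInducedBy A) (hA : IsPickands A) :
    C.spearmanRho = 12 * IsPickands.rhoIntegral A - 3 := by
  have hfin : volume (Ioo (0 : ℝ) 1 ×ˢ Ioo (0 : ℝ) 1 : Set (ℝ × ℝ)) < ⊤ := by
    rw [Measure.volume_eq_prod, Measure.prod_prod]
    exact ENNReal.mul_lt_top (by simp) (by simp)
  have hint : IntegrableOn (fun p : ℝ × ℝ => C.cdf p.1 p.2) (Ioo (0 : ℝ) 1 ×ˢ Ioo (0 : ℝ) 1) := by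
    have : IsFiniteMeasure (volume.restrict (Ioo (0 : ℝ) 1 ×ˢ Ioo (0 : ℝ) 1 : Set (ℝ × ℝ))) :=
      ⟨by simpa using hfin⟩
    refine Integrable.of_bound C.measurable_cdf.aestronglyMeasurable 1
      (Eventually.of_forall fun p => ?_)
    rw [Real.norm_of_nonneg (C.cdf_nonneg _ _)]
    exact C.cdf_le_one _ _
  unfold spearmanRho IsPickands.rhoIntegral
  rw [setIntegral_congr_set unitSquare_ae_eq, setIntegral_unitSquare hint]
  congr 2
  refine setIntegral_congr_fun measurableSet_Ioo fun t ht => ?_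
  rw [← integral_id_mul_exp_neg_mul (hA.add_pos zero_le_one (Ioo_subset_Icc_self ht))]
  refine setIntegral_congr_fun measurableSet_Ioi fun r hr => ?_
  rw [h.cdf_squareParam ht hr, mul_assoc, ← Real.exp_add]
  congr 2
  ring

/-- In the polar coordinates the factor `xy = e^{-r}` in the denominator cancels against the
Jacobian. This leaves `ab · r e^{-2Ar}`, whose integral over `r` is `ab / (4A²)`. -/
theorem IsInducedBy.kendallTau_eq (h : C.IsInducedBy A) (hA : IsPickands A) :
    C.kendallTau = 1 - IsPickands.tauIntegral A := by
  obtain ⟨hint, heq⟩ := C.integral_cdf_eq_of_hasDerivWithinAt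
    (F := fun p => C.cdf p.1 p.2
      * IsPickands.tangentOne A (Real.log p.1 / Real.log (p.1 * p.2)) / p.1)
    (G := fun p => C.cdf p.1 p.2
      * IsPickands.tangentZero A (Real.log p.1 / Real.log (p.1 * p.2)) / p.2)
    (fun x hx y hy => h.hasDerivWithinAt_left hA hx hy)
    (fun x hx y hy => h.hasDerivWithinAt_right hA hx hy)
  have key : ∫ p in Ioo (0 : ℝ) 1 ×ˢ Ioo (0 : ℝ) 1, (C.cdf p.1 p.2
      * IsPickands.tangentOne A (Real.log p.1 / Real.log (p.1 * p.2)) / p.1) * (C.cdf p.1 p.2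
      * IsPickands.tangentZero A (Real.log p.1 / Real.log (p.1 * p.2)) / p.2)
      = IsPickands.tauIntegral A / 4 := by
    unfold IsPickands.tauIntegral
    rw [setIntegral_unitSquare hint, ← integral_div]
    refine setIntegral_congr_fun measurableSet_Ioo fun t ht => ?_
    have hp := hA.add_pos le_rfl (Ioo_subset_Icc_self ht)
    rw [zero_add] at hp
    have e := integral_id_mul_exp_neg_mul (mul_pos two_pos hp)
    calc _ = ∫ r in Ioi (0 : ℝ), IsPickands.tangentOne A t * IsPickands.tangentZero A t
          * (r * Real.exp (-(2 * A t * r))) := by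
          refine setIntegral_congr_fun measurableSet_Ioi fun r hr => ?_
          rw [h.cdf_squareParam ht hr]
          simp only [squareParam]
          rw [log_div_log_mul_exp hr]
          have e1 : Real.exp (-r) = Real.exp (-(r * t)) * Real.exp (-(r * (1 - t))) := by
            rw [← Real.exp_add]
            congr 1
            ring
          have e2 : Real.exp (-(2 * A t * r)) = Real.exp (-(A t * r)) * Real.exp (-(A t * r)) := by
            rw [← Real.exp_add]
            congr 1
            ring
          rw [e1, e2]
          have := Real.exp_ne_zero (-(r * t))
          have := Real.exp_ne_zero (-(r * (1 - t)))
          field_simp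
      _ = _ := by
          rw [integral_const_mul, e]
          field_simp
          norm_num
  unfold kendallTau
  rw [heq, key]
  ring

end Copula

/-! ### Pickands representation of extreme-value copulas -/

/-- A continuous function that lies below some interior point of each of its chords is convex. -/
theorem convexOn_Icc_of_exists_le_chord {f : ℝ → ℝ} (hf : ContinuousOn f (Icc 0 1))
    (h : ∀ p ∈ Ioo (0 : ℝ) 1, ∀ q ∈ Ioo (0 : ℝ) 1, p < q → ∃ a b : ℝ, 0 < a ∧ 0 < b ∧
      a + b = 1 ∧ f (a * p + b * q) ≤ a * f p + b * f q) : ConvexOn ℝ (Icc 0 1) f := by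
  have open_case : ConvexOn ℝ (Ioo 0 1) f := by
    refine LinearOrder.convexOn_of_lt (convex_Ioo 0 1) ?_
    intro p hp q hq hpq a b ha hb hab
    simp only [smul_eq_mul]
    by_contra! hlt
    set m := (f q - f p) / (q - p) with hm
    have hmq : m * (q - p) = f q - f p := div_mul_cancel₀ _ (sub_pos.2 hpq).ne'
    set ψ : ℝ → ℝ := fun w => f w - f p - m * (w - p) with hψ
    have hψc : ContinuousOn ψ (Icc 0 1) := by fun_prop
    set z := a * p + b * q with hz
    have hzp : z - p = b * (q - p) := by linear_combination p * hab
    have hpz : p < z := by nlinarith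
    have hzq : z < q := by
      have : q - z = a * (q - p) := by linear_combination (-q) * hab
      nlinarith
    have hψz : 0 < ψ z := by
      have : m * (z - p) = b * (f q - f p) := by rw [hzp, ← hmq]; ring
      simp only [hψ]
      rw [this]
      have : a = 1 - b := by linarith
      subst this
      linarith
    have cl : ∀ u v : ℝ, 0 ≤ u → v ≤ 1 → IsCompact (Icc u v ∩ ψ ⁻¹' Iic 0) := by
      intro u v hu hv
      exact isCompact_Icc.of_isClosed_subset
        ((hψc.mono (Icc_subset_Icc hu hv)).preimage_isClosed_of_isClosed isClosed_Icc isClosed_Iic)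
        inter_subset_left
    -- If `f` exceeds its chord at `z`, take the nearest points `l < z < r` where it does not. The
    -- hypothesis, applied to the chord over `[l, r]`, produces a nearer one.
    obtain ⟨l, hl, hlmax⟩ := (cl p z hp.1.le (hzq.trans hq.2).le).exists_isGreatest
      ⟨p, ⟨le_rfl, hpz.le⟩, by simp [hψ]⟩
    obtain ⟨r, hr, hrmin⟩ := (cl z q (hp.1.trans hpz).le hq.2.le).exists_isLeast
      ⟨q, ⟨hzq.le, le_rfl⟩, by simp [hψ, hmq]⟩
    have hlz : l < z := hl.1.2.lt_of_ne fun e => by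
      have := hl.2
      rw [e] at this
      exact absurd hψz (not_lt.2 this)
    have hzr : z < r := hr.1.1.lt_of_ne fun e => by
      have := hr.2
      rw [← e] at this
      exact absurd hψz (not_lt.2 this)
    obtain ⟨c, d, hc, hd, hcd, hle⟩ := h l ⟨hp.1.trans_le hl.1.1, hlz.trans (hzq.trans hq.2)⟩
      r ⟨(hp.1.trans hpz).trans hzr, hr.1.2.trans_lt hq.2⟩ (hlz.trans hzr)
    set s := c * l + d * r with hs
    have hd' : d = 1 - c := by linarith
    have hls : l < s := by
      have : s - l = d * (r - l) := by rw [hs, hd']; ring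
      nlinarith
    have hsr : s < r := by
      have : r - s = c * (r - l) := by rw [hs, hd']; ring
      nlinarith
    have hψs : ψ s ≤ 0 := by
      have h1 : ψ l ≤ 0 := hl.2
      have h2 : ψ r ≤ 0 := hr.2
      have h3 : ψ s ≤ c * ψ l + d * ψ r := by
        simp only [hψ]
        rw [hd'] at hle hs ⊢
        have e : m * (s - p) = c * (m * (l - p)) + (1 - c) * (m * (r - p)) := by rw [hs]; ring
        rw [e]
        linarith
      nlinarith
    rcases le_total s z with hsz | hsz
    · exact absurd (hlmax ⟨⟨hl.1.1.trans hls.le, hsz⟩, hψs⟩) (not_le.2 hls)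
    · exact absurd (hrmin ⟨⟨hsz, hsr.le.trans hr.1.2⟩, hψs⟩) (not_le.2 hsr)
  -- The endpoints are reached by shrinking towards `1/2` and using continuity.
  refine ⟨convex_Icc 0 1, fun x hx y hy a b ha hb hab => ?_⟩
  set φ : ℝ → ℝ → ℝ := fun w ε => w + ε * (1 / 2 - w) with hφ
  have hin : ∀ w ∈ Icc (0 : ℝ) 1, ∀ ε ∈ Ioo (0 : ℝ) 1, φ w ε ∈ Ioo (0 : ℝ) 1 := by
    intro w hw ε hε
    simp only [hφ]
    constructor <;> nlinarith [hw.1, hw.2, hε.1, hε.2]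
  have lim : ∀ w ∈ Icc (0 : ℝ) 1, Tendsto (fun ε => f (φ w ε)) (𝓝[>] 0) (𝓝 (f w)) := by
    intro w hw
    refine (hf w hw).tendsto.comp (tendsto_nhdsWithin_iff.2 ⟨?_, ?_⟩)
    · have : Continuous (φ w) := by fun_prop
      exact (this.tendsto' 0 _ (by simp [hφ])).mono_left inf_le_left
    · filter_upwards [Ioo_mem_nhdsGT zero_lt_one] with ε hε
      exact Ioo_subset_Icc_self (hin w hw ε hε)
  have hxy : a • x + b • y ∈ Icc (0 : ℝ) 1 := convex_Icc 0 1 hx hy ha hb hab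
  refine le_of_tendsto_of_tendsto (lim _ hxy) (((lim x hx).const_mul a).add
    ((lim y hy).const_mul b)) ?_
  filter_upwards [Ioo_mem_nhdsGT zero_lt_one] with ε hε
  have := open_case.2 (hin x hx ε hε) (hin y hy ε hε) ha hb hab
  have e : a • φ x ε + b • φ y ε = φ (a • x + b • y) ε := by
    have : b = 1 - a := by linarith
    subst this
    simp only [hφ, smul_eq_mul]
    ring
  rwa [e] at this

namespace Copula

variable {C : Copula}

theorem cdf_add_sub_one_le (C : Copula) {x y : ℝ} (hx : x ∈ Icc (0 : ℝ) 1)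
    (hy : y ∈ Icc (0 : ℝ) 1) : x + y - 1 ≤ C.cdf x y := by
  have := C.cdf_rectangle hx.2 hy.2
  rw [C.cdf_one_right hx, C.cdf_one_left hy] at this
  linarith [C.cdf_le_one 1 1]

/-- Max-stability: pass to the subsequence `n = k m` in the defining limit at `(x^k, y^k)`. -/
theorem IsExtremeValue.cdf_pow (h : C.IsExtremeValue) {x y : ℝ} (hx : x ∈ Icc (0 : ℝ) 1)
    (hy : y ∈ Icc (0 : ℝ) 1) {k : ℕ} (hk : k ≠ 0) : C.cdf (x ^ k) (y ^ k) = C.cdf x y ^ k := by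
  obtain ⟨B, hB⟩ := h
  have hpow : ∀ z ∈ Icc (0 : ℝ) 1, z ^ k ∈ Icc (0 : ℝ) 1 := fun z hz =>
    ⟨pow_nonneg hz.1 k, pow_le_one₀ hz.1 hz.2⟩
  have h1 := (hB _ (hpow x hx) _ (hpow y hy)).comp
    (tendsto_id.const_mul_atTop' (Nat.pos_of_ne_zero hk))
  have h2 := (hB x hx y hy).pow k
  refine tendsto_nhds_unique h1 (h2.congr fun m => ?_)
  have e : ∀ z ∈ Icc (0 : ℝ) 1, (z ^ k) ^ (1 / ((k * m : ℕ) : ℝ)) = z ^ (1 / (m : ℝ)) := by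
    intro z hz
    rw [← Real.rpow_natCast, ← Real.rpow_mul hz.1]
    congr 1
    push_cast
    have : (k : ℝ) ≠ 0 := Nat.cast_ne_zero.2 hk
    field_simp
  simp only [Function.comp, id]
  rw [e x hx, e y hy, ← pow_mul, mul_comm]

/-- The stable tail dependence function `ℓ(a,b) = -log C(e^{-a}, e^{-b})`. -/
noncomputable def stdf (C : Copula) (a b : ℝ) : ℝ :=
  -Real.log (C.cdf (Real.exp (-a)) (Real.exp (-b)))

theorem exp_neg_mem {a : ℝ} (ha : 0 ≤ a) : Real.exp (-a) ∈ Icc (0 : ℝ) 1 :=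
  ⟨(Real.exp_pos _).le, by simpa using ha⟩

theorem IsExtremeValue.cdf_exp_nat (h : C.IsExtremeValue) {a b : ℝ} (ha : 0 ≤ a) (hb : 0 ≤ b)
    {k : ℕ} (hk : k ≠ 0) : C.cdf (Real.exp (-(k * a))) (Real.exp (-(k * b)))
      = C.cdf (Real.exp (-a)) (Real.exp (-b)) ^ k := by
  rw [← h.cdf_pow (exp_neg_mem ha) (exp_neg_mem hb) hk, ← Real.exp_nat_mul, ← Real.exp_nat_mul,
    mul_neg, mul_neg]

/-- For large `n` the point with exponents `a/n`, `b/n` is so near `(1,1)` that `C ≥ x + y - 1 > 0`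
there; max-stability carries positivity back. -/
theorem IsExtremeValue.cdf_exp_pos (h : C.IsExtremeValue) {a b : ℝ} (ha : 0 ≤ a) (hb : 0 ≤ b) :
    0 < C.cdf (Real.exp (-a)) (Real.exp (-b)) := by
  have l : ∀ c : ℝ, Tendsto (fun n : ℕ => Real.exp (-(c / n))) atTop (𝓝 1) := by
    intro c
    have := (tendsto_const_div_atTop_nhds_zero_nat c).neg.rexp
    simpa using this
  have l2 := ((l a).add (l b)).eventually (lt_mem_nhds (by norm_num : (1 : ℝ) < 1 + 1))
  obtain ⟨n, hn, hn0⟩ := (l2.and (eventually_ne_atTop 0)).exists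
  have hn' : (n : ℝ) ≠ 0 := Nat.cast_ne_zero.2 hn0
  have ha' : 0 ≤ a / n := by positivity
  have hb' : 0 ≤ b / n := by positivity
  have := h.cdf_exp_nat ha' hb' hn0
  rw [mul_div_cancel₀ _ hn', mul_div_cancel₀ _ hn'] at this
  rw [this]
  refine pow_pos ?_ n
  linarith [C.cdf_add_sub_one_le (exp_neg_mem ha') (exp_neg_mem hb')]

theorem IsExtremeValue.exp_neg_stdf (h : C.IsExtremeValue) {a b : ℝ} (ha : 0 ≤ a) (hb : 0 ≤ b) :
    Real.exp (-C.stdf a b) = C.cdf (Real.exp (-a)) (Real.exp (-b)) := by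
  rw [stdf, neg_neg, Real.exp_log (h.cdf_exp_pos ha hb)]

theorem IsExtremeValue.continuousAt_stdf (h : C.IsExtremeValue) {a b : ℝ} (ha : 0 ≤ a)
    (hb : 0 ≤ b) : ContinuousAt (fun p : ℝ × ℝ => C.stdf p.1 p.2) (a, b) := by
  have h1 : Continuous fun p : ℝ × ℝ => C.cdf (Real.exp (-p.1)) (Real.exp (-p.2)) :=
    C.continuous_cdf.comp (f := fun p : ℝ × ℝ => (Real.exp (-p.1), Real.exp (-p.2))) (by fun_prop)
  exact (h1.continuousAt.log (h.cdf_exp_pos ha hb).ne').neg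

theorem IsExtremeValue.stdf_nat_mul (h : C.IsExtremeValue) {a b : ℝ} (ha : 0 ≤ a) (hb : 0 ≤ b)
    {k : ℕ} (hk : k ≠ 0) : C.stdf (k * a) (k * b) = k * C.stdf a b := by
  rw [stdf, h.cdf_exp_nat ha hb hk, Real.log_pow, stdf]
  ring

/-- Integer homogeneity gives rational homogeneity; approximate `s` by `⌊s n⌋ / n` and use
continuity. -/
theorem IsExtremeValue.stdf_mul (h : C.IsExtremeValue) {a b s : ℝ} (ha : 0 ≤ a) (hb : 0 ≤ b)
    (hs : 0 < s) : C.stdf (s * a) (s * b) = s * C.stdf a b := by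
  have l : Tendsto (fun n : ℕ => (⌊s * n⌋₊ : ℝ) / n) atTop (𝓝 s) :=
    (tendsto_nat_floor_mul_div_atTop hs.le).comp tendsto_natCast_atTop_atTop
  have c : ContinuousAt (fun u : ℝ => C.stdf (u * a) (u * b)) s :=
    ContinuousAt.comp (f := fun u : ℝ => (u * a, u * b))
      (h.continuousAt_stdf (mul_nonneg hs.le ha) (mul_nonneg hs.le hb)) (by fun_prop)
  refine tendsto_nhds_unique (c.tendsto.comp l) ((l.mul_const (C.stdf a b)).congr' ?_)
  filter_upwards [eventually_ge_atTop (⌈1 / s⌉₊ + 1)] with n hn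
  have hn0 : n ≠ 0 := by omega
  have hn' : (n : ℝ) ≠ 0 := Nat.cast_ne_zero.2 hn0
  have hf : ⌊s * n⌋₊ ≠ 0 := by
    have h1 : 1 / s ≤ n := (Nat.le_ceil _).trans (Nat.cast_le.2 (by omega))
    rw [div_le_iff₀ hs] at h1
    exact (Nat.floor_pos.2 (by linarith)).ne'
  have ha' : 0 ≤ a / n := by positivity
  have hb' : 0 ≤ b / n := by positivity
  have e1 := h.stdf_nat_mul ha' hb' hf
  have e2 := h.stdf_nat_mul ha' hb' hn0
  rw [mul_div_cancel₀ _ hn', mul_div_cancel₀ _ hn'] at e2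
  simp only [Function.comp]
  rw [div_mul_comm, mul_comm (_ / _), div_mul_comm _ _ a, mul_comm (a / n),
    div_mul_comm _ _ b, mul_comm (b / n), e1, e2]
  field_simp

/-- By homogeneity `C` equals `e^{-sℓ}` along a ray. The rectangle inequality for `C`, linearized at
the corner `(1,1)` as `s → 0`, is submodularity of `ℓ`. -/
theorem IsExtremeValue.stdf_submodular (h : C.IsExtremeValue) {a a' b b' : ℝ} (ha : 0 ≤ a)
    (hb : 0 ≤ b) (haa : a ≤ a') (hbb : b ≤ b') :
    C.stdf a b + C.stdf a' b' ≤ C.stdf a' b + C.stdf a b' := by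
  have ha' := ha.trans haa
  have hb' := hb.trans hbb
  have l : ∀ c d : ℝ, 0 ≤ c → 0 ≤ d → Tendsto
      (fun s => (C.cdf (Real.exp (-(s * c))) (Real.exp (-(s * d))) - 1) / s) (𝓝[>] 0)
      (𝓝 (-C.stdf c d)) := by
    intro c d hc hd
    have d0 : HasDerivAt (fun s => Real.exp (s * -C.stdf c d)) (-C.stdf c d) 0 := by
      simpa using ((hasDerivAt_id (0 : ℝ)).mul_const (-C.stdf c d)).exp
    have := (hasDerivWithinAt_iff_tendsto_slope' (by simp)).1 (d0.hasDerivWithinAt (s := Ioi 0))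
    refine this.congr' ?_
    filter_upwards [self_mem_nhdsWithin] with s hs
    rw [← h.exp_neg_stdf (mul_nonneg (le_of_lt hs) hc) (mul_nonneg (le_of_lt hs) hd),
      h.stdf_mul hc hd hs, slope_def_field]
    simp
  have hle := le_of_tendsto_of_tendsto ((l a' b ha' hb).add (l a b' ha hb'))
    ((l a b ha hb).add (l a' b' ha' hb')) (by
      filter_upwards [self_mem_nhdsWithin] with s hs
      rw [mem_Ioi] at hs
      rw [← add_div, ← add_div]
      refine div_le_div_of_nonneg_right ?_ hs.le
      have := C.cdf_rectangle (x := Real.exp (-(s * a'))) (x' := Real.exp (-(s * a)))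
        (y := Real.exp (-(s * b'))) (y' := Real.exp (-(s * b)))
        (Real.exp_le_exp.2 (neg_le_neg (mul_le_mul_of_nonneg_left haa hs.le)))
        (Real.exp_le_exp.2 (neg_le_neg (mul_le_mul_of_nonneg_left hbb hs.le)))
      linarith)
  linarith

theorem IsExtremeValue.isPickands (h : C.IsExtremeValue) :
    IsPickands fun t => C.stdf t (1 - t) := by
  constructor
  · refine convexOn_Icc_of_exists_le_chord ?_ ?_
    · intro t ht
      refine ContinuousAt.continuousWithinAt ?_
      exact ContinuousAt.comp (f := fun u : ℝ => (u, 1 - u))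
        (h.continuousAt_stdf ht.1 (sub_nonneg.2 ht.2)) (by fun_prop)
    · intro p hp q hq hpq
      have hp1 := sub_pos.2 hp.2
      have hq1 := sub_pos.2 hq.2
      -- Submodularity is applied to the rectangle with opposite corners `α (p, 1-p)` and `β (q,
      -- 1-q)`. The weights satisfy `α² p(1-p) = β² q(1-q)`, which puts its other two corners on one
      -- ray, the one through `(s, 1-s)`. Homogeneity then gives `(α+β) f(s) ≤ α f(p) + β f(q)`.
      set α := √(q * (1 - q)) with hα
      set β := √(p * (1 - p)) with hβ
      have hα0 : 0 < α := Real.sqrt_pos.2 (mul_pos hq.1 hq1)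
      have hβ0 : 0 < β := Real.sqrt_pos.2 (mul_pos hp.1 hp1)
      have hα2 : α ^ 2 = q * (1 - q) := Real.sq_sqrt (mul_pos hq.1 hq1).le
      have hβ2 : β ^ 2 = p * (1 - p) := Real.sq_sqrt (mul_pos hp.1 hp1).le
      have rel : α ^ 2 * (p * (1 - p)) = β ^ 2 * (q * (1 - q)) := by rw [hα2, hβ2]; ring
      have hαβ : 0 < α + β := by linarith
      refine ⟨α / (α + β), β / (α + β), by positivity, by positivity, by field_simp, ?_⟩
      set s := α / (α + β) * p + β / (α + β) * q with hs
      have hs' : s * (α + β) = α * p + β * q := by rw [hs]; field_simp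
      have hs0 : 0 ≤ s := by have := hp.1; have := hq.1; positivity
      have hs1 : 0 ≤ 1 - s := by
        have : (1 - s) * (α + β) = α * (1 - p) + β * (1 - q) := by linarith
        by_contra! hc
        nlinarith [mul_pos hα0 hp1, mul_pos hβ0 hq1]
      have c1 : α * p ≤ β * q := by
        refine le_of_sq_le_sq ?_ (mul_pos hβ0 hq.1).le
        rw [mul_pow, mul_pow, hα2, hβ2]
        nlinarith [mul_pos hp.1 hq.1]
      have c2 : β * (1 - q) ≤ α * (1 - p) := by
        refine le_of_sq_le_sq ?_ (mul_pos hα0 hp1).le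
        rw [mul_pow, mul_pow, hα2, hβ2]
        nlinarith [mul_pos hp1 hq1]
      have sub := h.stdf_submodular (mul_pos hα0 hp.1).le (mul_pos hβ0 hq1).le c1 c2
      set m := α * p + β * (1 - q) with hm
      set n := β * q + α * (1 - p) with hn
      have hm0 : 0 < m := add_pos (mul_pos hα0 hp.1) (mul_pos hβ0 hq1)
      have hn0 : 0 < n := add_pos (mul_pos hβ0 hq.1) (mul_pos hα0 hp1)
      have hmn : m + n = α + β := by rw [hm, hn]; ring
      have e1 : m * s = α * p := by
        refine mul_right_cancel₀ hαβ.ne' ?_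
        rw [mul_assoc, hs', hm]
        linear_combination -rel
      have e2 : m * (1 - s) = β * (1 - q) := by rw [mul_sub, e1, hm]; ring
      have e3 : n * s = β * q := by
        have : n * s = s * (α + β) - m * s := by rw [← hmn]; ring
        rw [this, e1, hs']
        ring
      have e4 : n * (1 - s) = α * (1 - p) := by rw [mul_sub, e3, hn]; ring
      rw [← e1, ← e2, ← e3, ← e4, h.stdf_mul hs0 hs1 hm0, h.stdf_mul hs0 hs1 hn0, e1, e2, e3, e4,
        h.stdf_mul hq.1.le hq1.le hβ0, h.stdf_mul hp.1.le hp1.le hα0, ← add_mul, hmn] at sub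
      have : α / (α + β) * C.stdf p (1 - p) + β / (α + β) * C.stdf q (1 - q)
          = (β * C.stdf q (1 - q) + α * C.stdf p (1 - p)) / (α + β) := by field_simp; ring
      rw [this, le_div_iff₀ hαβ]
      linarith
  · intro t ht
    have ht1 := sub_nonneg.2 ht.2
    have hpos := h.cdf_exp_pos ht.1 ht1
    refine ⟨max_le ?_ ?_, ?_⟩
    · have := Real.log_le_log hpos (C.cdf_le_right (exp_neg_mem ht1) _)
      rw [Real.log_exp] at this
      simp only [stdf]
      linarith
    · have := Real.log_le_log hpos (C.cdf_le_left (exp_neg_mem ht.1) _)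
      rw [Real.log_exp] at this
      simp only [stdf]
      linarith
    -- With one corner at the origin, submodularity becomes subadditivity across the axes: `ℓ(t,
    -- 1-t) ≤ ℓ(t, 0) + ℓ(0, 1-t) = 1`.
    · have sub := h.stdf_submodular le_rfl le_rfl ht.1 ht1
      have e0 : C.stdf 0 0 = 0 := by
        simp [stdf, C.cdf_one_right (x := 1) (by simp)]
      have e1 : C.stdf t 0 = t := by
        simp [stdf, C.cdf_one_right (exp_neg_mem ht.1)]
      have e2 : C.stdf 0 (1 - t) = 1 - t := by
        have := C.cdf_one_left (exp_neg_mem ht1)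
        rw [stdf, neg_zero, Real.exp_zero, this, Real.log_exp, neg_neg]
      simp only
      linarith

theorem IsExtremeValue.isInducedBy (h : C.IsExtremeValue) :
    C.IsInducedBy fun t => C.stdf t (1 - t) := by
  intro x hx y hy
  have hm : (x, y) ∈ Ioo (0 : ℝ) 1 ×ˢ Ioo (0 : ℝ) 1 := ⟨hx, hy⟩
  rw [← squareParam_image] at hm
  obtain ⟨⟨t, r⟩, ⟨ht, hr⟩, e⟩ := hm
  simp only [squareParam, Prod.mk.injEq] at e
  obtain ⟨rfl, rfl⟩ := e
  have hr' : 0 < r := hr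
  have ht1 : 0 ≤ 1 - t := sub_nonneg.2 ht.2.le
  simp only
  rw [log_div_log_mul_exp hr', ← h.exp_neg_stdf (mul_nonneg hr'.le ht.1.le)
    (mul_nonneg hr'.le ht1), h.stdf_mul ht.1.le ht1 hr', ← Real.exp_add, ← Real.exp_mul]
  congr 1
  ring

end Copula

/-! ### The copulas `M` and `Π` -/

namespace Copula

variable {C : Copula} {A : ℝ → ℝ}

theorem tendsto_cdf_rpow_pow {B : Copula} {x y l : ℝ}
    (h : ∀ n : ℕ, n ≠ 0 → B.cdf (x ^ (1 / (n : ℝ))) (y ^ (1 / (n : ℝ))) ^ n = l) :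
    Tendsto (fun n : ℕ => B.cdf (x ^ (1 / (n : ℝ))) (y ^ (1 / (n : ℝ))) ^ n) atTop (𝓝 l) := by
  refine tendsto_const_nhds.congr' ?_
  filter_upwards [eventually_ne_atTop 0] with n hn using (h n hn).symm

theorem rpow_one_div_mem {x : ℝ} (hx : x ∈ Icc (0 : ℝ) 1) (n : ℕ) :
    x ^ (1 / (n : ℝ)) ∈ Icc (0 : ℝ) 1 :=
  ⟨Real.rpow_nonneg hx.1 _, Real.rpow_le_one hx.1 hx.2 (by positivity)⟩

theorem rpow_one_div_pow {x : ℝ} (hx : 0 ≤ x) {n : ℕ} (hn : n ≠ 0) :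
    (x ^ (1 / (n : ℝ))) ^ n = x := by
  rw [one_div, Real.rpow_inv_natCast_pow hx hn]

theorem comonotonic_isExtremeValue : comonotonic.IsExtremeValue := by
  refine ⟨comonotonic, fun x hx y hy => tendsto_cdf_rpow_pow fun n hn => ?_⟩
  rw [comonotonic_cdf (rpow_one_div_mem hx n) (rpow_one_div_mem hy n), comonotonic_cdf hx hy]
  rcases le_total x y with h | h
  · rw [min_eq_left h, min_eq_left (Real.rpow_le_rpow hx.1 h (by positivity)),
      rpow_one_div_pow hx.1 hn]
  · rw [min_eq_right h, min_eq_right (Real.rpow_le_rpow hy.1 h (by positivity)),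
      rpow_one_div_pow hy.1 hn]

theorem product_isExtremeValue : product.IsExtremeValue := by
  refine ⟨product, fun x hx y hy => tendsto_cdf_rpow_pow fun n hn => ?_⟩
  rw [product_cdf (rpow_one_div_mem hx n) (rpow_one_div_mem hy n), product_cdf hx hy, mul_pow,
    rpow_one_div_pow hx.1 hn, rpow_one_div_pow hy.1 hn]

theorem ext_of_cdf_Ioo {C D : Copula}
    (h : ∀ x ∈ Ioo (0 : ℝ) 1, ∀ y ∈ Ioo (0 : ℝ) 1, C.cdf x y = D.cdf x y) : C = D := by
  refine ext_of_cdf fun x hx y hy => ?_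
  rcases hx.1.eq_or_lt with hx0 | hx0
  · rw [C.cdf_of_nonpos hx0.symm.le, D.cdf_of_nonpos hx0.symm.le]
  rcases hx.2.eq_or_lt with hx1 | hx1
  · rw [hx1, C.cdf_one_left hy, D.cdf_one_left hy]
  rcases hy.1.eq_or_lt with hy0 | hy0
  · rw [C.cdf_of_nonpos' hy0.symm.le, D.cdf_of_nonpos' hy0.symm.le]
  rcases hy.2.eq_or_lt with hy1 | hy1
  · rw [hy1, C.cdf_one_right hx, D.cdf_one_right hx]
  exact h x ⟨hx0, hx1⟩ y ⟨hy0, hy1⟩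

theorem IsInducedBy.eq_of_eqOn {D : Copula} {A' : ℝ → ℝ} (h : C.IsInducedBy A)
    (h' : D.IsInducedBy A') (hA : ∀ t ∈ Ioo (0 : ℝ) 1, A t = A' t) : C = D :=
  ext_of_cdf_Ioo fun x hx y hy => by rw [h x hx y hy, h' x hx y hy, hA _ (log_ratio_mem hx hy)]

theorem IsInducedBy.eqOn {A' : ℝ → ℝ} (h : C.IsInducedBy A) (h' : C.IsInducedBy A')
    {t : ℝ} (ht : t ∈ Ioo (0 : ℝ) 1) : A t = A' t := by
  have e := (h.cdf_squareParam ht one_pos).symm.trans (h'.cdf_squareParam ht one_pos)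
  simpa using e

theorem isInducedBy_comonotonic : comonotonic.IsInducedBy fun t => max t (1 - t) := by
  intro x hx y hy
  have hlx := Real.log_neg hx.1 hx.2
  have hly := Real.log_neg hy.1 hy.2
  have hl : Real.log (x * y) = Real.log x + Real.log y := Real.log_mul hx.1.ne' hy.1.ne'
  have hneg : Real.log (x * y) < 0 := by rw [hl]; linarith
  have hy' : 1 - Real.log x / Real.log (x * y) = Real.log y / Real.log (x * y) := by
    rw [eq_div_iff hneg.ne, sub_mul, div_mul_cancel₀ _ hneg.ne, hl]
    ring
  rw [comonotonic_cdf (Ioo_subset_Icc_self hx) (Ioo_subset_Icc_self hy),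
    Real.rpow_def_of_pos (mul_pos hx.1 hy.1)]
  simp only [hy']
  rcases le_total x y with h | h
  · have hle := Real.log_le_log hx.1 h
    rw [min_eq_left h, max_eq_left ((div_le_div_right_of_neg hneg).2 hle),
      mul_div_cancel₀ _ hneg.ne, Real.exp_log hx.1]
  · have hle := Real.log_le_log hy.1 h
    rw [min_eq_right h, max_eq_right ((div_le_div_right_of_neg hneg).2 hle),
      mul_div_cancel₀ _ hneg.ne, Real.exp_log hy.1]

theorem isInducedBy_product : product.IsInducedBy fun _ => 1 := by
  intro x hx y hy
  rw [product_cdf (Ioo_subset_Icc_self hx) (Ioo_subset_Icc_self hy), Real.rpow_one]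

theorem IsInducedBy.eq_comonotonic_iff (h : C.IsInducedBy A) (hA : IsPickands A) :
    C = comonotonic ↔ ∀ t ∈ Icc (0 : ℝ) 1, A t = max t (1 - t) := by
  constructor
  · rintro rfl t ht
    rcases ht.1.eq_or_lt with h0 | h0
    · simp [← h0, hA.zero]
    rcases ht.2.eq_or_lt with h1 | h1
    · simp [h1, hA.one]
    exact h.eqOn isInducedBy_comonotonic ⟨h0, h1⟩
  · intro hm
    exact h.eq_of_eqOn isInducedBy_comonotonic fun t ht => hm t (Ioo_subset_Icc_self ht)

theorem IsInducedBy.eq_product_iff (h : C.IsInducedBy A) (hA : IsPickands A) :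
    C = product ↔ ∀ t ∈ Icc (0 : ℝ) 1, A t = 1 := by
  constructor
  · rintro rfl t ht
    rcases ht.1.eq_or_lt with h0 | h0
    · rw [← h0, hA.zero]
    rcases ht.2.eq_or_lt with h1 | h1
    · rw [h1, hA.one]
    exact h.eqOn isInducedBy_product ⟨h0, h1⟩
  · intro hm
    exact h.eq_of_eqOn isInducedBy_product fun t ht => hm t (Ioo_subset_Icc_self ht)

theorem kendallTau_comonotonic : comonotonic.kendallTau = 1 := by
  have : ∫ p, comonotonic.cdf p.1 p.2 ∂comonotonic.measure = 1 / 2 := by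
    rw [← integral_id_unit]
    simp only [comonotonic.eq_def]
    rw [integral_map (by fun_prop) (measurable_cdf _).aestronglyMeasurable]
    refine setIntegral_congr_fun measurableSet_Icc fun x hx => ?_
    exact (comonotonic_cdf hx hx).trans (min_self x)
  unfold kendallTau
  rw [this]
  norm_num

theorem _root_.isPickands_max : IsPickands fun t => max t (1 - t) := by
  refine ⟨?_, fun t ht => ⟨(max_comm _ _).le, max_le ht.2 (by linarith [ht.1])⟩⟩
  have h1 : ConvexOn ℝ (Icc (0 : ℝ) 1) fun t : ℝ => t := convexOn_id (convex_Icc 0 1)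
  have h2 : ConvexOn ℝ (Icc (0 : ℝ) 1) fun t : ℝ => 1 - t :=
    (convexOn_const 1 (convex_Icc 0 1)).sub (concaveOn_id (convex_Icc 0 1))
  exact h1.sup h2

theorem rhoIntegral_max : IsPickands.rhoIntegral (fun t => max t (1 - t)) = 1 / 3 := by
  have hi := isPickands_max.integrableOn_rho
  have hs : (1 / 2 : ℝ) ∈ Ioo (0 : ℝ) 1 := by constructor <;> norm_num
  have e0 : EqOn (fun t : ℝ => 1 / (1 + max t (1 - t)) ^ 2) (fun t => 1 / (2 - t) ^ 2)
      (Ioo 0 (1 / 2)) := by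
    intro t ht
    simp only
    rw [max_eq_right (by linarith [ht.2])]
    ring
  have e1 : EqOn (fun t : ℝ => 1 / (1 + max t (1 - t)) ^ 2) (fun t => 1 / (1 + t) ^ 2)
      (Ioo (1 / 2) 1) := by
    intro t ht
    simp only
    rw [max_eq_left (by linarith [ht.1])]
  have i0 := (hi.mono_set (Ioo_subset_Ioo_right hs.2.le)).congr_fun e0 measurableSet_Ioo
  have i1 := (hi.mono_set (Ioo_subset_Ioo_left hs.1.le)).congr_fun e1 measurableSet_Ioo
  have c0 := IsPickands.integral_rightDeriv le_rfl hs.1.le hs.2.le (g := fun t => 1 / (2 - t))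
    (ContinuousOn.div (by fun_prop) (by fun_prop) fun t ht => by linarith [ht.2])
    (fun t ht => by
      refine (((hasDerivAt_const t (1 : ℝ)).div ((hasDerivAt_id' t).const_sub 2)
        (by linarith [ht.2])).congr_deriv ?_).hasDerivWithinAt
      ring) i0
  have c1 := IsPickands.integral_rightDeriv hs.1.le hs.2.le le_rfl (g := fun t => -1 / (1 + t))
    (ContinuousOn.div (by fun_prop) (by fun_prop) fun t ht => by linarith [ht.1])
    (fun t ht => by
      refine (((hasDerivAt_const t (-1 : ℝ)).div ((hasDerivAt_id' t).const_add 1)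
        (by linarith [ht.1])).congr_deriv ?_).hasDerivWithinAt
      ring) i1
  unfold IsPickands.rhoIntegral
  rw [IsPickands.setIntegral_split hi hs, setIntegral_congr_fun measurableSet_Ioo e0,
    setIntegral_congr_fun measurableSet_Ioo e1, c0, c1]
  norm_num

theorem spearmanRho_comonotonic : comonotonic.spearmanRho = 1 := by
  rw [isInducedBy_comonotonic.spearmanRho_eq isPickands_max, rhoIntegral_max]
  norm_num

theorem IsInducedBy.kendallTau_nonneg (h : C.IsInducedBy A) (hA : IsPickands A) :
    0 ≤ C.kendallTau := by
  have ht : (1 / 2 : ℝ) ∈ Ioo (0 : ℝ) 1 := by constructor <;> norm_num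
  have h1 := hA.tauIntegral_le ht
  have h2 : 1 ≤ 1 / A (1 / 2) := by
    have := hA.half_le (Ioo_subset_Icc_self ht)
    rw [le_div_iff₀ (by linarith)]
    linarith [hA.le_one (Ioo_subset_Icc_self ht)]
  rw [h.kendallTau_eq hA]
  linarith

theorem IsInducedBy.eq_product_of_kendallTau (h : C.IsInducedBy A) (hA : IsPickands A)
    (h0 : C.kendallTau = 0) : C = product := by
  refine h.eq_of_eqOn isInducedBy_product fun t ht => ?_
  have h1 := hA.tauIntegral_le ht
  rw [h.kendallTau_eq hA] at h0
  have hp := hA.half_le (Ioo_subset_Icc_self ht)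
  have h2 : 1 / A t ≤ 1 := by linarith
  rw [div_le_one (by linarith)] at h2
  exact le_antisymm (hA.le_one (Ioo_subset_Icc_self ht)) h2

/-- Substituting `T = 1 - τ` and `I = (ρ + 3)/12` turns `one_sub_tauIntegral_mul_le` into `3τ ≤ ρ (2
+ τ)`. -/
theorem IsInducedBy.three_mul_kendallTau_div_le (h : C.IsInducedBy A) (hA : IsPickands A) :
    3 * C.kendallTau / (2 + C.kendallTau) ≤ C.spearmanRho := by
  have h0 := h.kendallTau_nonneg hA
  have h1 := hA.one_sub_tauIntegral_mul_le
  rw [div_le_iff₀ (by linarith)]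
  rw [h.kendallTau_eq hA, h.spearmanRho_eq hA]
  linarith

/-- No direct integration: `τ ≥ 0`, while `ρ = 0` and `3τ/(2+τ) ≤ ρ` give `τ ≤ 0`. -/
theorem kendallTau_product : product.kendallTau = 0 := by
  have hA : IsPickands fun _ => 1 :=
    ⟨convexOn_const 1 (convex_Icc 0 1), fun t ht => ⟨max_le (by linarith [ht.1]) ht.2, le_rfl⟩⟩
  have h0 := isInducedBy_product.kendallTau_nonneg hA
  have h1 := isInducedBy_product.three_mul_kendallTau_div_le hA
  rw [isInducedBy_product.spearmanRho_eq hA, div_le_iff₀ (by linarith)] at h1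
  have : IsPickands.rhoIntegral (fun _ => 1) = 1 / 4 := by
    norm_num [IsPickands.rhoIntegral]
  rw [this] at h1
  linarith

theorem spearmanRho_product : product.spearmanRho = 0 := by
  have hA : IsPickands fun _ => 1 :=
    ⟨convexOn_const 1 (convex_Icc 0 1), fun t ht => ⟨max_le (by linarith [ht.1]) ht.2, le_rfl⟩⟩
  rw [isInducedBy_product.spearmanRho_eq hA]
  norm_num [IsPickands.rhoIntegral]

end Copula

/-! ### Comparison of the bounds and conclusion -/

theorem neg_one_add_sqrt_le {τ : ℝ} (h0 : 0 ≤ τ) (h1 : τ ≤ 1) :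
    -1 + √(1 + 3 * τ) ≤ 3 * τ / (2 + τ) := by
  have : √(1 + 3 * τ) ≤ 1 + 3 * τ / (2 + τ) := by
    refine Real.sqrt_le_iff.2 ⟨by positivity, ?_⟩
    have e : (1 + 3 * τ / (2 + τ)) ^ 2 - (1 + 3 * τ) = 3 * τ ^ 2 * (1 - τ) / (2 + τ) ^ 2 := by
      field_simp
      ring
    have : 0 ≤ 3 * τ ^ 2 * (1 - τ) / (2 + τ) ^ 2 :=
      div_nonneg (mul_nonneg (by positivity) (by linarith)) (by positivity)
    linarith
  linarith

/-- The squared gap `3τ²(1-τ)/(2+τ)²` vanishes only at `τ = 0` and `τ = 1`; this is what isolates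
the equality cases. -/
theorem neg_one_add_sqrt_lt {τ : ℝ} (h0 : 0 < τ) (h1 : τ < 1) :
    -1 + √(1 + 3 * τ) < 3 * τ / (2 + τ) := by
  have : √(1 + 3 * τ) < 1 + 3 * τ / (2 + τ) := by
    refine (Real.sqrt_lt' (by positivity)).2 ?_
    have e : (1 + 3 * τ / (2 + τ)) ^ 2 - (1 + 3 * τ) = 3 * τ ^ 2 * (1 - τ) / (2 + τ) ^ 2 := by
      field_simp
      ring
    have : 0 < 3 * τ ^ 2 * (1 - τ) / (2 + τ) ^ 2 :=
      div_pos (mul_pos (by positivity) (by linarith)) (by positivity)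
    linarith
  linarith

namespace Copula

variable {C : Copula} {A : ℝ → ℝ}

theorem IsInducedBy.spearmanRho_eq_iff (h : C.IsInducedBy A) (hA : IsPickands A) :
    C.spearmanRho = -1 + √(1 + 3 * C.kendallTau) ↔ C = comonotonic ∨ C = product := by
  constructor
  · intro he
    by_contra! hne
    have h0 : 0 < C.kendallTau := (h.kendallTau_nonneg hA).lt_of_ne fun e =>
      hne.2 (h.eq_product_of_kendallTau hA e.symm)
    have h1 : C.kendallTau < 1 := C.kendallTau_le_one.lt_of_ne fun e =>
      hne.1 (C.eq_comonotonic_of_kendallTau e)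
    exact absurd (he ▸ h.three_mul_kendallTau_div_le hA) (not_le.2 (neg_one_add_sqrt_lt h0 h1))
  · rintro (rfl | rfl)
    · rw [kendallTau_comonotonic, spearmanRho_comonotonic]
      have : √(1 + 3 * 1) = 2 := by
        rw [Real.sqrt_eq_iff_mul_self_eq] <;> norm_num
      rw [this]
      norm_num
    · rw [kendallTau_product, spearmanRho_product]
      simp

end Copula

theorem mainTheorem2 :
    (∀ C : Copula, C.IsExtremeValue →
      0 ≤ C.kendallTau ∧ C.spearmanRho ≥ -1 + √(1 + 3 * C.kendallTau)) ∧
    (∀ C : Copula,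
      (C.IsExtremeValue ∧ C.spearmanRho = -1 + √(1 + 3 * C.kendallTau)) ↔
        (C = Copula.comonotonic ∨ C = Copula.product)) ∧
    (∀ A : ℝ → ℝ, IsPickands A → ∀ C : Copula, C.IsInducedBy A →
      (C.spearmanRho = -1 + √(1 + 3 * C.kendallTau) ↔
        (∀ t ∈ Set.Icc (0 : ℝ) 1, A t = max t (1 - t)) ∨ (∀ t ∈ Set.Icc (0 : ℝ) 1, A t = 1)) ∧
      (C = Copula.comonotonic ↔ ∀ t ∈ Set.Icc (0 : ℝ) 1, A t = max t (1 - t)) ∧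
      (C = Copula.product ↔ ∀ t ∈ Set.Icc (0 : ℝ) 1, A t = 1)) ∧
    (∀ C : Copula, C.IsExtremeValue → C ≠ Copula.comonotonic → C ≠ Copula.product →
      C.spearmanRho ≥ 3 * C.kendallTau / (2 + C.kendallTau) ∧
      3 * C.kendallTau / (2 + C.kendallTau) > C.kendallTau) := by
  refine ⟨fun C h => ?_, fun C => ⟨fun h => ?_, fun h => ?_⟩, fun A hA C h => ?_,
    fun C h hM hP => ?_⟩
  · have h0 := h.isInducedBy.kendallTau_nonneg h.isPickands
    exact ⟨h0, (neg_one_add_sqrt_le h0 C.kendallTau_le_one).trans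
      (h.isInducedBy.three_mul_kendallTau_div_le h.isPickands)⟩
  · exact (h.1.isInducedBy.spearmanRho_eq_iff h.1.isPickands).1 h.2
  · have hE : C.IsExtremeValue := by
      rcases h with rfl | rfl
      exacts [Copula.comonotonic_isExtremeValue, Copula.product_isExtremeValue]
    exact ⟨hE, (hE.isInducedBy.spearmanRho_eq_iff hE.isPickands).2 h⟩
  · have hM := h.eq_comonotonic_iff hA
    have hP := h.eq_product_iff hA
    exact ⟨by rw [← hM, ← hP, h.spearmanRho_eq_iff hA], hM, hP⟩
  · have h0 : 0 < C.kendallTau := (h.isInducedBy.kendallTau_nonneg h.isPickands).lt_of_ne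
      fun e => hP (h.isInducedBy.eq_product_of_kendallTau h.isPickands e.symm)
    have h1 : C.kendallTau < 1 := C.kendallTau_le_one.lt_of_ne fun e =>
      hM (C.eq_comonotonic_of_kendallTau e)
    refine ⟨h.isInducedBy.three_mul_kendallTau_div_le h.isPickands, ?_⟩
    -- What is left amounts to `τ (1 - τ) > 0`.
    rw [gt_iff_lt, lt_div_iff₀ (by linarith)]
    nlinarith
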